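/- Let $\omega = e^{2\pi i/3}$. An $n$-qutrit stabilizer state is a vector of $(\mathbb{C}^3)^{\otimes n}$ of the form $$|\sigma\rangle = 3^{-k/2} \sum_{y \in \mathbb{F}_3^k} \omega^{Q(y)}\, |x_0 + W y\rangle,$$ where $k \ge 0$, $x_0 \in \mathbb{F}_3^n$, $W \in \mathbb{F}_3^{n \times k}$ has full column rank, and $Q$ is a polynomial of degree at most $2$ in $k$ variables over $\mathbb{F}_3$ (linear and constant terms allowed). The stabilizer rank $\chi(|\psi\rangle)$ of $|\psi\rangle \in (\mathbb{C}^3)^{\otimes n}$ is the least $r$ such that $|\psi\rangle = \sum_{i=1}^r c_i |\sigma_i\rangle$ with $c_i \in \mathbb{C}$ and $n$-qutrit stabilizer states $|\sigma_i\rangle$. For a single-qutrit state $|M\rangle$ put $$\gamma_M = \limsup_{m \to \infty} \frac{\log_3 \chi(|M\rangle^{\otimes m})}{m}.$$ Consider the Strange, Hadamard-eigenstate and Norrell states $$|\mathbb{S}\rangle = \tfrac{1}{\sqrt 2}\big(|1\rangle - |2\rangle\big), \quad |H_3\rangle = \tfrac{1}{\sqrt{3 - \sqrt 3}}\Big(|0\rangle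 + \tfrac{\sqrt 3 - 1}{2}\big(|1\rangle + |2\rangle\big)\Big), \quad |\mathbb{N}\rangle = \tfrac{1}{\sqrt 6}\big(|0\rangle + |1\rangle - 2|2\rangle\big).$$ **Theorem 2.** For each $|M\rangle \in \{|\mathbb{S}\rangle, |H_3\rangle, |\mathbb{N}\rangle\}$, $$\chi\big(|M\rangle^{\otimes 3}\big) = 4 \qquad\text{and}\qquad \gamma_M \le \tfrac{1}{3}\log_3 4 .$$ -/

import Mathlib

noncomputable section

/-- The computational basis vector `|z⟩` of the space `ℂ^ι` of amplitude functions on `ι`. -/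
def ket {ι : Type} [DecidableEq ι] (z : ι) : ι → ℂ :=
  Pi.single z 1

/-- Vectors of the `n`-qutrit space `(ℂ³)^{⊗ n}`, given by their amplitudes in the
computational basis, which is indexed by `𝔽₃ⁿ`. -/
abbrev QutritVec (n : ℕ) : Type :=
  (Fin n → ZMod 3) → ℂ

/-- The primitive third root of unity `ω = e^{2πi/3}`. -/
def omega : ℂ :=
  Complex.exp (2 * Real.pi * Complex.I / 3)

/-- The vector `3^{-k/2} ∑_{y ∈ 𝔽₃ᵏ} ω^{Q(y)} |x₀ + W y⟩`. -/
def canonicalState {n k : ℕ} (x₀ : Fin n → ZMod 3) (W : Matrix (Fin n) (Fin k) (ZMod 3))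
    (Q : MvPolynomial (Fin k) (ZMod 3)) : QutritVec n :=
  ((1 / Real.sqrt (3 ^ k) : ℝ) : ℂ) •
    ∑ y : Fin k → ZMod 3, omega ^ (MvPolynomial.eval y Q).val • ket (x₀ + W.mulVec y)

/-- `n`-qutrit stabilizer states: the vectors `3^{-k/2} ∑_{y ∈ 𝔽₃ᵏ} ω^{Q(y)} |x₀ + W y⟩` with
`W ∈ 𝔽₃^{n × k}` of full column rank and `Q` a polynomial of degree at most two
(linear and constant terms are allowed). -/
def IsStabilizerState {n : ℕ} (σ : QutritVec n) : Prop :=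
  ∃ (k : ℕ) (x₀ : Fin n → ZMod 3) (W : Matrix (Fin n) (Fin k) (ZMod 3))
    (Q : MvPolynomial (Fin k) (ZMod 3)),
    W.rank = k ∧ Q.totalDegree ≤ 2 ∧ σ = canonicalState x₀ W Q

/-- `ψ` is a complex linear combination of `r` stabilizer states. -/
def HasStabilizerDecomposition {n : ℕ} (ψ : QutritVec n) (r : ℕ) : Prop :=
  ∃ (c : Fin r → ℂ) (σ : Fin r → QutritVec n),
    (∀ i, IsStabilizerState (σ i)) ∧ ψ = ∑ i, c i • σ i

/-- Computational basis vectors are stabilizer states. -/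
theorem isStabilizerState_ket {n : ℕ} (x : Fin n → ZMod 3) :
    IsStabilizerState (ket x) := by
  refine ⟨0, x, 0, 0, by simp, by simp, ?_⟩
  simp [canonicalState]

/-- Every vector has a stabilizer decomposition, so the minimum defining the stabilizer rank is
over a non-empty set. -/
theorem exists_hasStabilizerDecomposition {n : ℕ} (ψ : QutritVec n) :
    ∃ r, HasStabilizerDecomposition ψ r := by
  let e := (Fintype.equivFin (Fin n → ZMod 3)).symm
  refine ⟨_, fun i => ψ (e i), fun i => ket (e i), fun i => isStabilizerState_ket _, ?_⟩
  rw [Equiv.sum_comp e (fun x => ψ x • (ket x : QutritVec n))]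
  funext z
  simp [ket, Pi.single_apply]

/-- The stabilizer rank `χ(ψ)`: the least number of stabilizer states whose linear span
contains `ψ`. -/
def stabilizerRank {n : ℕ} (ψ : QutritVec n) : ℕ :=
  sInf {r : ℕ | HasStabilizerDecomposition ψ r}

/-- The tensor power `|M⟩^{⊗ m}` of a single-qutrit vector: its amplitude at
`x = (x₁, …, x_m)` is `∏ᵢ M(xᵢ)`. -/
def tensorPower (M : ZMod 3 → ℂ) (m : ℕ) : QutritVec m :=
  fun x => ∏ i, M (x i)

/-- The per-copy asymptotic stabilizer-rank exponent
`γ_M = limsup_{m → ∞} log₃ χ(|M⟩^{⊗ m}) / m`, as an extended real. -/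
def asymptoticExponent (M : ZMod 3 → ℂ) : EReal :=
  Filter.limsup
    (fun m : ℕ => ((Real.logb 3 (stabilizerRank (tensorPower M m)) / m : ℝ) : EReal))
    Filter.atTop

/-- The Strange state `(|1⟩ - |2⟩) / √2`. -/
def strangeState : ZMod 3 → ℂ :=
  ((1 / Real.sqrt 2 : ℝ) : ℂ) • (ket 1 - ket 2)

/-- The Hadamard eigenstate
`(|0⟩ + ((√3 - 1) / 2) (|1⟩ + |2⟩)) / √(3 - √3)`. -/
def hadamardEigenstate : ZMod 3 → ℂ :=
  ((1 / Real.sqrt (3 - Real.sqrt 3) : ℝ) : ℂ) •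
    (ket 0 + (((Real.sqrt 3 - 1) / 2 : ℝ) : ℂ) • (ket 1 + ket 2))

/-- The Norrell state `(|0⟩ + |1⟩ - 2 |2⟩) / √6`. -/
def norrellState : ZMod 3 → ℂ :=
  ((1 / Real.sqrt 6 : ℝ) : ℂ) • (ket 0 + ket 1 - (2 : ℂ) • ket 2)

end

/-! Upper bound. A vector with one value at `b` and another elsewhere has a cube depending only on
the number of coordinates different from `b`. Modulo 3 this number is a sum of squares, so three
quadratic phases suffice, plus one basis vector separating the counts 0 and 3. For the Strange state
the amplitude is the quadratic character of `xyz`, a product of two differences of phases in `xy`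
and in `z`. Tensoring decompositions makes the rank submultiplicative, which gives the exponent
(`asymptoticExponent_le`).

Lower bound. Fix a place of `ℂ` above 2. After rescaling and shifting the basis, each `M` reduces to
`(0, 1, 1)`, so its cube reduces to the indicator of the corners `{1, 2}³`. A stabilizer state is a
scalar times `1_A ω^q`, with `A` affine and `q` quadratic. Suppose three of them combine to the cube
of `M`. If all coefficients are integral, reducing and projecting the residue field onto `𝔽₄` writes
the corner indicator as a sum of at most three functions `1_B ω^q` over `𝔽₄`, against
`no_cube_relation`. Otherwise, dividing by a largest coefficient gives a nontrivial relation over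
`𝔽₄`. It forces a relation over `ℂ` among the same functions
(`exists_relation_of_sum_fourLabel_eq_zero`), which eliminates a term; induct on the number of
terms.

For `no_cube_relation`, the covering pattern forces two supports to be the whole space
(`CubeCover.exists_two_eq_univ`). On the coordinate planes the third support is then where the
difference of the two phases is nonzero, and a finite check on quadratic functions excludes this. -/

/-! ### Affine sets and quadratic functions over `𝔽₃`. -/

/-- Over `𝔽₃`, a set is an affine subspace (or empty) exactly when it contains, with any two
points, the third point of the line through them. -/
def ThirdPointClosed {V : Type*} [AddCommGroup V] (A : Set V) : Prop :=
  ∀ x ∈ A, ∀ y ∈ A, -x - y ∈ A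

/-- Functions of the form `x ↦ l x + c` with `l` linear. -/
def IsAffineFunctional {n : ℕ} (f : (Fin n → ZMod 3) → ZMod 3) : Prop :=
  ∃ (l : (Fin n → ZMod 3) →ₗ[ZMod 3] ZMod 3) (c : ZMod 3), ∀ x, f x = l x + c

/-- The space of functions of degree at most two on `𝔽₃ⁿ`. -/
def quadraticFunctions (n : ℕ) : Submodule (ZMod 3) ((Fin n → ZMod 3) → ZMod 3) :=
  Submodule.span (ZMod 3) {f | ∃ a b, IsAffineFunctional a ∧ IsAffineFunctional b ∧ f = a * b}

theorem isAffineFunctional_const {n : ℕ} (c : ZMod 3) :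
    IsAffineFunctional (fun _ : Fin n → ZMod 3 => c) := ⟨0, c, by simp⟩

theorem isAffineFunctional_coord {n : ℕ} (i : Fin n) :
    IsAffineFunctional (fun x : Fin n → ZMod 3 => x i) := ⟨LinearMap.proj i, 0, by simp⟩

theorem mul_mem_quadraticFunctions {n : ℕ} {a b : (Fin n → ZMod 3) → ZMod 3}
    (ha : IsAffineFunctional a) (hb : IsAffineFunctional b) : a * b ∈ quadraticFunctions n :=
  Submodule.subset_span ⟨a, b, ha, hb, rfl⟩

theorem const_mem_quadraticFunctions {n : ℕ} (c : ZMod 3) :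
    (fun _ => c) ∈ quadraticFunctions n := by
  have := mul_mem_quadraticFunctions (isAffineFunctional_const (n := n) c)
    (isAffineFunctional_const 1)
  convert this using 1
  ext; simp

theorem eval_mem_quadraticFunctions {n : ℕ} (Q : MvPolynomial (Fin n) (ZMod 3))
    (hQ : Q.totalDegree ≤ 2) :
    (fun y => MvPolynomial.eval y Q) ∈ quadraticFunctions n := by
  have h : (fun y => MvPolynomial.eval y Q) = ∑ d ∈ Q.support,
      Q.coeff d • fun y : Fin n → ZMod 3 => (d.toMultiset.map y).prod := by
    ext y
    rw [MvPolynomial.eval_eq]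
    simp only [Finset.sum_apply, Pi.smul_apply, smul_eq_mul, Finsupp.toMultiset_map,
      Finsupp.prod_toMultiset]
    refine Finset.sum_congr rfl fun d _ => ?_
    rw [Finsupp.prod_mapDomain_index (by simp) (by simp [pow_add])]
    rfl
  rw [h]
  refine Submodule.sum_mem _ fun d hd => Submodule.smul_mem _ _ ?_
  have hc : d.toMultiset.card ≤ 2 := by
    rw [Finsupp.card_toMultiset]
    exact (MvPolynomial.le_totalDegree hd).trans hQ
  interval_cases hk : d.toMultiset.card
  · rw [Multiset.card_eq_zero] at hk
    simp only [hk, Multiset.map_zero, Multiset.prod_zero]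
    exact const_mem_quadraticFunctions 1
  · obtain ⟨i, hi⟩ := Multiset.card_eq_one.1 hk
    simp only [hi, Multiset.map_singleton, Multiset.prod_singleton]
    convert mul_mem_quadraticFunctions (isAffineFunctional_coord i) (isAffineFunctional_const 1)
      using 1
    ext; simp
  · obtain ⟨i, j, hi⟩ := Multiset.card_eq_two.1 hk
    simp only [hi, Multiset.insert_eq_cons, Multiset.map_cons, Multiset.map_singleton,
      Multiset.prod_cons, Multiset.prod_singleton]
    exact mul_mem_quadraticFunctions (isAffineFunctional_coord i) (isAffineFunctional_coord j)

theorem comp_affine_mem_quadraticFunctions {n k : ℕ} {q : (Fin k → ZMod 3) → ZMod 3}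
    (hq : q ∈ quadraticFunctions k) (L : (Fin n → ZMod 3) →ₗ[ZMod 3] (Fin k → ZMod 3))
    (v : Fin k → ZMod 3) : (fun x => q (L x + v)) ∈ quadraticFunctions n := by
  have key : ∀ a : (Fin k → ZMod 3) → ZMod 3, IsAffineFunctional a →
      IsAffineFunctional fun x => a (L x + v) := by
    rintro a ⟨l, c, h⟩
    exact ⟨l.comp L, l v + c, fun x => by simp [h, add_assoc]⟩
  induction hq using Submodule.span_induction with
  | mem f hf =>
    obtain ⟨a, b, ha, hb, rfl⟩ := hf
    exact mul_mem_quadraticFunctions (key a ha) (key b hb)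
  | zero => exact Submodule.zero_mem _
  | add f g _ _ hf hg => exact Submodule.add_mem _ hf hg
  | smul c f _ hf => exact Submodule.smul_mem _ c hf

/-- Three difference operators kill degree two. This is the coordinate-free form of the degree
bound. -/
theorem third_difference_eq_zero {n : ℕ} {q : (Fin n → ZMod 3) → ZMod 3}
    (hq : q ∈ quadraticFunctions n) (p u v w : Fin n → ZMod 3) :
    q (p + u + v + w) - q (p + u + v) - q (p + u + w) - q (p + v + w)
      + q (p + u) + q (p + v) + q (p + w) - q p = 0 := by
  induction hq using Submodule.span_induction with
  | mem f hf =>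
    obtain ⟨a, b, ⟨l, c, ha⟩, ⟨m, d, hb⟩, rfl⟩ := hf
    simp only [Pi.mul_apply, ha, hb, map_add]
    ring
  | zero => simp
  | add f g _ _ hf hg =>
    simp only [Pi.add_apply]
    linear_combination hf + hg
  | smul c f _ hf =>
    simp only [Pi.smul_apply, smul_eq_mul]
    linear_combination c * hf

/-- Makes the quadratic functions on `𝔽₃³` a finite list, open to exhaustive checking. -/
theorem exists_coefficients {q : (Fin 3 → ZMod 3) → ZMod 3} (hq : q ∈ quadraticFunctions 3) :
    ∃ A a₁ a₂ a₃ k₁ k₂ k₃ b₁₂ b₁₃ b₂₃ : ZMod 3, ∀ x y z : ZMod 3, q ![x, y, z] =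
      A + (a₁ * x + k₁ * (x * x)) + (a₂ * y + k₂ * (y * y)) + (a₃ * z + k₃ * (z * z))
        + b₁₂ * (x * y) + b₁₃ * (x * z) + b₂₃ * (y * z) := by
  induction hq using Submodule.span_induction with
  | mem f hf =>
    obtain ⟨a, b, ⟨l, c, ha⟩, ⟨m, d, hb⟩, rfl⟩ := hf
    have key : ∀ (l : (Fin 3 → ZMod 3) →ₗ[ZMod 3] ZMod 3) (x y z : ZMod 3), l ![x, y, z] =
        l ![1, 0, 0] * x + l ![0, 1, 0] * y + l ![0, 0, 1] * z := by
      intro l x y z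
      have : ![x, y, z] = x • ![1, 0, 0] + y • ![0, 1, 0] + z • ![0, 0, 1] := by
        ext i; fin_cases i <;> simp
      rw [this]
      simp only [map_add, map_smul, smul_eq_mul]
      ring
    refine ⟨c * d, l ![1, 0, 0] * d + m ![1, 0, 0] * c, l ![0, 1, 0] * d + m ![0, 1, 0] * c,
      l ![0, 0, 1] * d + m ![0, 0, 1] * c, l ![1, 0, 0] * m ![1, 0, 0],
      l ![0, 1, 0] * m ![0, 1, 0], l ![0, 0, 1] * m ![0, 0, 1],
      l ![1, 0, 0] * m ![0, 1, 0] + l ![0, 1, 0] * m ![1, 0, 0],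
      l ![1, 0, 0] * m ![0, 0, 1] + l ![0, 0, 1] * m ![1, 0, 0],
      l ![0, 1, 0] * m ![0, 0, 1] + l ![0, 0, 1] * m ![0, 1, 0], fun x y z => ?_⟩
    rw [Pi.mul_apply, ha, hb, key l x, key m x]
    ring
  | zero => exact ⟨0, 0, 0, 0, 0, 0, 0, 0, 0, 0, by simp⟩
  | add f g _ _ hf hg =>
    obtain ⟨A, a₁, a₂, a₃, k₁, k₂, k₃, b₁₂, b₁₃, b₂₃, h⟩ := hf
    obtain ⟨A', a₁', a₂', a₃', k₁', k₂', k₃', b₁₂', b₁₃', b₂₃', h'⟩ := hg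
    refine ⟨A + A', a₁ + a₁', a₂ + a₂', a₃ + a₃', k₁ + k₁', k₂ + k₂', k₃ + k₃', b₁₂ + b₁₂',
      b₁₃ + b₁₃', b₂₃ + b₂₃', fun x y z => ?_⟩
    rw [Pi.add_apply, h, h']
    ring
  | smul c f _ hf =>
    obtain ⟨A, a₁, a₂, a₃, k₁, k₂, k₃, b₁₂, b₁₃, b₂₃, h⟩ := hf
    refine ⟨c * A, c * a₁, c * a₂, c * a₃, c * k₁, c * k₂, c * k₃, c * b₁₂, c * b₁₃, c * b₂₃,
      fun x y z => ?_⟩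
    rw [Pi.smul_apply, h, smul_eq_mul]
    ring

/-! ### Stabilizer states as affine indicators with quadratic phases. -/

theorem canonicalState_apply {n k : ℕ} (x₀ : Fin n → ZMod 3)
    (W : Matrix (Fin n) (Fin k) (ZMod 3)) (Q : MvPolynomial (Fin k) (ZMod 3))
    (z : Fin n → ZMod 3) :
    canonicalState x₀ W Q z = ((1 / Real.sqrt (3 ^ k) : ℝ) : ℂ) *
      ∑ y : Fin k → ZMod 3,
        omega ^ (MvPolynomial.eval y Q).val * if z = x₀ + W.mulVec y then 1 else 0 := by
  simp [canonicalState, ket, Finset.sum_apply, Pi.single_apply]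

theorem mulVec_injective_of_rank_eq {n k : ℕ} {W : Matrix (Fin n) (Fin k) (ZMod 3)}
    (h : W.rank = k) : Function.Injective W.mulVecLin := by
  rw [← LinearMap.ker_eq_bot, ← Submodule.finrank_eq_zero]
  have := W.mulVecLin.finrank_range_add_finrank_ker
  rw [Module.finrank_fin_fun] at this
  unfold Matrix.rank at h
  omega

theorem rank_eq_of_mulVec_injective {n k : ℕ} {W : Matrix (Fin n) (Fin k) (ZMod 3)}
    (h : Function.Injective W.mulVecLin) : W.rank = k := by
  rw [Matrix.rank, LinearMap.finrank_range_of_inj h, Module.finrank_fin_fun]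

/-- A left inverse of `W` turns `Q` into a quadratic function on all of `𝔽₃ⁿ`, so the
parametrization can be forgotten. -/
theorem IsStabilizerState.exists_indicator {n : ℕ} {σ : QutritVec n} (h : IsStabilizerState σ) :
    ∃ (A : Set (Fin n → ZMod 3)) (q : (Fin n → ZMod 3) → ZMod 3) (c : ℂ),
      A.Nonempty ∧ ThirdPointClosed A ∧ q ∈ quadraticFunctions n ∧
        ∀ x, σ x = c * A.indicator (fun x => omega ^ (q x).val) x := by
  obtain ⟨k, x₀, W, Q, hW, hQ, rfl⟩ := h
  have hinj := mulVec_injective_of_rank_eq hW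
  obtain ⟨L, hL⟩ := W.mulVecLin.exists_leftInverse_of_injective (LinearMap.ker_eq_bot.2 hinj)
  have hL' : ∀ y, L (W.mulVec y) = y := fun y => LinearMap.congr_fun hL y
  refine ⟨Set.range fun y => x₀ + W.mulVec y, fun x => MvPolynomial.eval (L x + -L x₀) Q, _,
    ⟨_, 0, rfl⟩, ?_, comp_affine_mem_quadraticFunctions (eval_mem_quadraticFunctions Q hQ) L _,
    fun x => (canonicalState_apply x₀ W Q x).trans (congrArg _ ?_)⟩
  · rintro _ ⟨y, rfl⟩ _ ⟨z, rfl⟩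
    refine ⟨-y - z, ?_⟩
    simp only [Matrix.mulVec_sub, Matrix.mulVec_neg]
    have h3 : ∀ t : ZMod 3, t = -t - t := by decide
    ext i
    simp only [Pi.add_apply, Pi.sub_apply, Pi.neg_apply]
    linear_combination h3 (x₀ i)
  · by_cases hx : x ∈ Set.range fun y => x₀ + W.mulVec y
    · rw [Set.indicator_of_mem hx]
      obtain ⟨y, rfl⟩ := hx
      rw [Finset.sum_eq_single y]
      · simp [hL']
      · intro z _ hz
        have : x₀ + W.mulVec y ≠ x₀ + W.mulVec z := fun e => hz (hinj (add_left_cancel e)).symm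
        simp [this]
      · simp
    · rw [Set.indicator_of_notMem hx]
      refine Finset.sum_eq_zero fun y _ => ?_
      have : x ≠ x₀ + W.mulVec y := fun e => hx ⟨y, e.symm⟩
      simp [this]

/-! ### Cube roots of unity, in `ℂ` and in the field with four elements. -/

theorem pow_val_add {R : Type*} [Monoid R] {ζ : R} (h : ζ ^ 3 = 1) (a b : ZMod 3) :
    ζ ^ (a + b).val = ζ ^ a.val * ζ ^ b.val := by
  rw [← pow_add, ZMod.val_add, ← pow_mod_orderOf, Nat.mod_mod_of_dvd _ (orderOf_dvd_of_pow_eq_one h),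
    pow_mod_orderOf]

theorem isPrimitiveRoot_omega : IsPrimitiveRoot omega 3 := by
  have := Complex.isPrimitiveRoot_exp 3 (by norm_num)
  convert this using 1
  simp [omega]

theorem omega_pow_three : omega ^ 3 = 1 := isPrimitiveRoot_omega.pow_eq_one

theorem one_add_omega_add_sq : 1 + omega + omega ^ 2 = 0 := by
  have := isPrimitiveRoot_omega.geom_sum_eq_zero (by norm_num)
  simpa [Finset.sum_range_succ] using this

/-- The nonzero elements `1, ω, ω²` of the field with four elements, as vectors over `𝔽₂` in the
basis `1, ω`. -/
def fourLabel (a : ZMod 3) : ZMod 2 × ZMod 2 :=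
  if a = 0 then (1, 0) else if a = 1 then (0, 1) else (1, 1)

/-! ### Coverings among affine sets. -/

namespace ThirdPointClosed

variable {V : Type*} [AddCommGroup V] {A B D : Set V}

theorem add_sub_mem (hA : ThirdPointClosed A) {x y z : V} (hx : x ∈ A) (hy : y ∈ A)
    (hz : z ∈ A) : x + y - z ∈ A := by
  have := hA _ (hA x hx y hy) z hz
  convert this using 1
  abel

/-- If `x ∈ A` avoids `B` and `y ∈ A` avoids `D`, the third point of their line can lie in neither
`B` nor `D`. -/
theorem subset_or_subset (hA : ThirdPointClosed A) (hB : ThirdPointClosed B)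
    (hD : ThirdPointClosed D) (h : A ⊆ B ∪ D) : A ⊆ B ∨ A ⊆ D := by
  by_contra! hc
  obtain ⟨⟨x, hxA, hxB⟩, ⟨y, hyA, hyD⟩⟩ := And.imp Set.not_subset.1 Set.not_subset.1 hc
  have hyB : y ∈ B := (h hyA).resolve_right hyD
  have hxD : x ∈ D := (h hxA).resolve_left hxB
  rcases h (hA x hxA y hyA) with hz | hz
  · exact hxB (by convert hB _ hz y hyB using 1; abel)
  · exact hyD (by convert hD _ hz x hxD using 1; abel)

theorem inter (hA : ThirdPointClosed A) (hB : ThirdPointClosed B) : ThirdPointClosed (A ∩ B) :=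
  fun x hx y hy => ⟨hA x hx.1 y hy.1, hB x hx.2 y hy.2⟩

/-- If each of three affine subspaces is covered by the two others, then two of them coincide and
contain the third one. -/
theorem exists_perm {B : Fin 3 → Set V} (hB : ∀ i, ThirdPointClosed (B i))
    (h : ∀ i, ∀ x ∈ B i, ∃ j ≠ i, x ∈ B j) :
    ∃ π : Equiv.Perm (Fin 3), B (π 0) = B (π 1) ∧ B (π 2) ⊆ B (π 0) := by
  have h0 : B 0 ⊆ B 1 ∪ B 2 := fun x hx => by
    obtain ⟨j, hj, hx⟩ := h 0 x hx
    fin_cases j <;> simp_all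
  have h1 : B 1 ⊆ B 0 ∪ B 2 := fun x hx => by
    obtain ⟨j, hj, hx⟩ := h 1 x hx
    fin_cases j <;> simp_all
  have h2 : B 2 ⊆ B 0 ∪ B 1 := fun x hx => by
    obtain ⟨j, hj, hx⟩ := h 2 x hx
    fin_cases j <;> simp_all
  have p01 : B 0 ⊆ B 1 → B 1 ⊆ B 0 → B 2 ⊆ B 0 →
      ∃ π : Equiv.Perm (Fin 3), B (π 0) = B (π 1) ∧ B (π 2) ⊆ B (π 0) :=
    fun a b c => ⟨1, a.antisymm b, c⟩
  have p02 : B 0 ⊆ B 2 → B 2 ⊆ B 0 → B 1 ⊆ B 0 →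
      ∃ π : Equiv.Perm (Fin 3), B (π 0) = B (π 1) ∧ B (π 2) ⊆ B (π 0) :=
    fun a b c => ⟨Equiv.swap 1 2, a.antisymm b, c⟩
  have p12 : B 1 ⊆ B 2 → B 2 ⊆ B 1 → B 0 ⊆ B 1 →
      ∃ π : Equiv.Perm (Fin 3), B (π 0) = B (π 1) ∧ B (π 2) ⊆ B (π 0) :=
    fun a b c => ⟨finRotate 3, a.antisymm b, c⟩
  rcases (hB 0).subset_or_subset (hB 1) (hB 2) h0 with a | a <;>
  rcases (hB 1).subset_or_subset (hB 0) (hB 2) h1 with b | b <;>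
  rcases (hB 2).subset_or_subset (hB 0) (hB 1) h2 with c | c
  · exact p01 a b c
  · exact p01 a b (c.trans b)
  · exact p02 (a.trans b) c (b.trans c)
  · exact p12 b c a
  · exact p02 a c b
  · exact p02 a (c.trans b) b
  · exact p02 a c (b.trans c)
  · exact p12 b c (a.trans c)

end ThirdPointClosed

/-! ### Lifting relations from `𝔽₄` to `ℂ`. -/

/-- In the third difference at `p` along `p' - p`, `u - p`, `u - p`, every point except `p` and `p'`
lies in `B` but off `D`. -/
theorem quadratic_eq_of_eq_zero_off {n : ℕ} {B D : Set (Fin n → ZMod 3)}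
    (hB : ThirdPointClosed B) (hD : ThirdPointClosed D) (hDB : D ⊆ B)
    {d : (Fin n → ZMod 3) → ZMod 3} (hd : d ∈ quadraticFunctions n)
    (h0 : ∀ x ∈ B, x ∉ D → d x = 0) {u : Fin n → ZMod 3} (hu : u ∈ B) (huD : u ∉ D)
    {p p' : Fin n → ZMod 3} (hp : p ∈ D) (hp' : p' ∈ D) : d p' = d p := by
  have h3 : ∀ x : Fin n → ZMod 3, x + x + x = 0 := fun x => by
    ext i
    exact (show ∀ a : ZMod 3, a + a + a = 0 by decide) (x i)
  have key := third_difference_eq_zero hd p (p' - p) (u - p) (u - p)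
  have e1 : d (p + (u - p)) = 0 := by
    rw [add_sub_cancel]; exact h0 u hu huD
  have f2 : p + (u - p) + (u - p) = -u - p := by
    linear_combination h3 u
  have e2 : d (p + (u - p) + (u - p)) = 0 := by
    rw [f2]
    refine h0 _ (hB u hu p (hDB hp)) fun h => huD ?_
    convert hD _ h p hp using 1
    abel
  have e3 : d (p + (p' - p) + (u - p)) = 0 := by
    have f : p + (p' - p) + (u - p) = p' + u - p := by abel
    rw [f]
    refine h0 _ (hB.add_sub_mem (hDB hp') hu (hDB hp)) fun h => huD ?_
    convert hD.add_sub_mem h hp hp' using 1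
    abel
  have e4 : d (p + (p' - p) + (u - p) + (u - p)) = 0 := by
    have f : p + (p' - p) + (u - p) + (u - p) = p' + (-u - p) - p := by
      linear_combination h3 u
    rw [f]
    refine h0 _ (hB.add_sub_mem (hDB hp') (hB u hu p (hDB hp)) (hDB hp)) fun h => huD ?_
    have h' := hD.add_sub_mem h hp hp'
    convert hD _ h' p hp using 1
    abel
  rw [e1, e2, e3, e4, add_sub_cancel] at key
  linear_combination key

theorem fourLabel_add_eq_zero : ∀ a b : ZMod 3, fourLabel a + fourLabel b = 0 → a = b := by
  decide

/-- Three nonzero elements of `𝔽₄` sum to zero only when they are distinct; their exponents then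
form a progression of step `a - b`. -/
theorem fourLabel_add_add_eq_zero : ∀ a b c : ZMod 3, fourLabel a + fourLabel b + fourLabel c = 0 →
    a ≠ b ∧ b = c + (a - b) ∧ a = c + ((a - b) + (a - b)) := by
  decide

theorem fourLabel_ne_zero : ∀ a : ZMod 3, fourLabel a ≠ 0 := by decide

theorem exists_cover_of_sum_fourLabel_eq_zero {V : Type*} {B : Fin 3 → Set V}
    {q : Fin 3 → V → ZMod 3} {x : V}
    (h : ∑ i, (B i).indicator (fun x => fourLabel (q i x)) x = 0) (i : Fin 3) (hx : x ∈ B i) :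
    ∃ j ≠ i, x ∈ B j := by
  by_contra! hc
  rw [Finset.sum_eq_single i (fun j _ hj => Set.indicator_of_notMem (hc j hj) _) (by simp),
    Set.indicator_of_mem hx] at h
  exact fourLabel_ne_zero _ h

theorem omega_pow_sum_eq_zero {δ : ZMod 3} (c : ZMod 3) (hδ : δ ≠ 0) :
    omega ^ (c + (δ + δ)).val + omega ^ (c + δ).val + omega ^ c.val = 0 := by
  rw [pow_val_add omega_pow_three c, pow_val_add omega_pow_three c]
  have h : omega ^ (δ + δ).val + omega ^ δ.val + 1 = 0 := by
    have : δ = 1 ∨ δ = 2 := by revert δ; decide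
    rcases this with rfl | rfl
    · have e1 : (1 + 1 : ZMod 3).val = 2 := rfl
      have e2 : (1 : ZMod 3).val = 1 := rfl
      rw [e1, e2]
      linear_combination one_add_omega_add_sq
    · have e1 : (2 + 2 : ZMod 3).val = 1 := rfl
      have e2 : (2 : ZMod 3).val = 2 := rfl
      rw [e1, e2]
      linear_combination one_add_omega_add_sq
  linear_combination omega ^ c.val * h

/-- Off `B 2` the phases `q 0` and `q 1` agree; on `B 2` the three phases are distinct. If `B 2 = B
0`, use `1 + ω + ω² = 0`. Otherwise `q 0 - q 1` is constant on `B 2`, so the difference of the first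
two functions is a multiple of the third. -/
theorem exists_relation_of_nested {n : ℕ} {B : Fin 3 → Set (Fin n → ZMod 3)}
    {q : Fin 3 → (Fin n → ZMod 3) → ZMod 3} (hB : ∀ i, ThirdPointClosed (B i))
    (hq : ∀ i, q i ∈ quadraticFunctions n)
    (h : ∀ x, ∑ i, (B i).indicator (fun x => fourLabel (q i x)) x = 0)
    (hne : ∃ i, (B i).Nonempty) (h01 : B 0 = B 1) (h20 : B 2 ⊆ B 0) :
    ∃ d : Fin 3 → ℂ, (∃ i, d i ≠ 0) ∧ (∀ i, d i ≠ 0 → (B i).Nonempty) ∧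
      ∀ x, ∑ i, d i * (B i).indicator (fun x => omega ^ (q i x).val) x = 0 := by
  have hne0 : (B 0).Nonempty := by
    obtain ⟨i, hi⟩ := hne
    fin_cases i
    · exact hi
    · exact h01 ▸ hi
    · exact hi.mono h20
  have hon : ∀ x ∈ B 2, q 0 x ≠ q 1 x ∧ q 1 x = q 2 x + (q 0 x - q 1 x) ∧
      q 0 x = q 2 x + ((q 0 x - q 1 x) + (q 0 x - q 1 x)) := fun x hx => by
    have := h x
    rw [Fin.sum_univ_three, Set.indicator_of_mem (h20 hx), Set.indicator_of_mem (h01 ▸ h20 hx),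
      Set.indicator_of_mem hx] at this
    exact fourLabel_add_add_eq_zero _ _ _ this
  have hoff : ∀ x ∈ B 0, x ∉ B 2 → q 0 x = q 1 x := fun x hx hx2 => by
    have := h x
    rw [Fin.sum_univ_three, Set.indicator_of_mem hx, Set.indicator_of_mem (h01 ▸ hx),
      Set.indicator_of_notMem hx2, add_zero] at this
    exact fourLabel_add_eq_zero _ _ this
  by_cases h2 : B 0 ⊆ B 2
  · refine ⟨fun _ => 1, ⟨0, one_ne_zero⟩, fun i _ => ?_, fun x => ?_⟩
    · fin_cases i
      · exact hne0
      · exact h01 ▸ hne0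
      · exact hne0.mono h2
    · by_cases hx : x ∈ B 2
      · rw [Fin.sum_univ_three, Set.indicator_of_mem (h20 hx),
          Set.indicator_of_mem (h01 ▸ h20 hx), Set.indicator_of_mem hx]
        obtain ⟨ha, hb, hc⟩ := hon x hx
        have := omega_pow_sum_eq_zero (q 2 x) (sub_ne_zero.2 ha)
        rw [← hb, ← hc] at this
        linear_combination this
      · have hx0 : x ∉ B 0 := fun h => hx (h2 h)
        rw [Fin.sum_univ_three, Set.indicator_of_notMem hx0,
          Set.indicator_of_notMem (h01 ▸ hx0), Set.indicator_of_notMem hx]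
        simp
  obtain ⟨u, hu, hu2⟩ := Set.not_subset.1 h2
  rcases (B 2).eq_empty_or_nonempty with he | ⟨p, hp⟩
  · refine ⟨![1, -1, 0], ⟨0, one_ne_zero⟩, fun i hi => ?_, fun x => ?_⟩
    · fin_cases i
      · exact hne0
      · exact h01 ▸ hne0
      · simp at hi
    · rw [Fin.sum_univ_three, ← h01]
      by_cases hx : x ∈ B 0
      · simp [hx, hoff x hx (he ▸ Set.notMem_empty x)]
      · simp [hx]
  · set δ := q 0 p - q 1 p with hδ
    have hconst : ∀ x ∈ B 2, q 0 x - q 1 x = δ := fun x hx =>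
      quadratic_eq_of_eq_zero_off (hB 0) (hB 2) h20 (Submodule.sub_mem _ (hq 0) (hq 1))
        (fun y hy hy2 => sub_eq_zero.2 (hoff y hy hy2)) hu hu2 hp hx
    refine ⟨![1, -1, -(omega ^ (δ + δ).val - omega ^ δ.val)], ⟨0, one_ne_zero⟩, fun i hi => ?_,
      fun x => ?_⟩
    · fin_cases i
      · exact hne0
      · exact h01 ▸ hne0
      · exact ⟨p, hp⟩
    · rw [Fin.sum_univ_three, ← h01]
      by_cases hx : x ∈ B 0
      · by_cases hx2 : x ∈ B 2
        · obtain ⟨-, hb, hc⟩ := hon x hx2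
          rw [hconst x hx2] at hb hc
          simp only [Set.indicator_of_mem hx, Set.indicator_of_mem hx2, hb, hc,
            pow_val_add omega_pow_three (q 2 x)]
          simp
          ring
        · simp [hx, hx2, hoff x hx hx2]
      · have hx2 : x ∉ B 2 := fun h => hx (h20 h)
        simp [hx, hx2]

/-- A relation over the field with four elements between three functions `1_B ω^q` forces a
relation over `ℂ`. -/
theorem exists_relation_of_sum_fourLabel_eq_zero {n : ℕ} {B : Fin 3 → Set (Fin n → ZMod 3)}
    {q : Fin 3 → (Fin n → ZMod 3) → ZMod 3} (hB : ∀ i, ThirdPointClosed (B i))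
    (hq : ∀ i, q i ∈ quadraticFunctions n)
    (h : ∀ x, ∑ i, (B i).indicator (fun x => fourLabel (q i x)) x = 0)
    (hne : ∃ i, (B i).Nonempty) :
    ∃ d : Fin 3 → ℂ, (∃ i, d i ≠ 0) ∧ (∀ i, d i ≠ 0 → (B i).Nonempty) ∧
      ∀ x, ∑ i, d i * (B i).indicator (fun x => omega ^ (q i x).val) x = 0 := by
  obtain ⟨π, h01, h20⟩ := ThirdPointClosed.exists_perm hB fun i x hx =>
    exists_cover_of_sum_fourLabel_eq_zero (h x) i hx
  obtain ⟨d, ⟨i, hi⟩, hd, hsum⟩ := exists_relation_of_nested (B := B ∘ π) (q := q ∘ π)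
    (fun i => hB _) (fun i => hq _)
    (fun x => (Equiv.sum_comp π fun i => (B i).indicator (fun x => fourLabel (q i x)) x).trans
      (h x))
    (let ⟨i, hi⟩ := hne; ⟨π.symm i, by simpa using hi⟩) h01 h20
  refine ⟨d ∘ π.symm, ⟨π i, by simpa using hi⟩, fun i hi => by simpa using hd _ hi, fun x => ?_⟩
  rw [← hsum x, ← Equiv.sum_comp π]
  simp

/-! ### Exhaustive check on quadratic functions of three variables. -/

/-- The value at `(x, y, z)` of the quadratic polynomial with the given coefficients. -/
def quadraticValue (A a₁ k₁ a₂ k₂ b₁₂ a₃ k₃ b₁₃ b₂₃ x y z : ZMod 3) : ZMod 3 :=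
  A + (a₁ * x + k₁ * (x * x)) + (a₂ * y + k₂ * (y * y)) + (a₃ * z + k₃ * (z * z))
    + b₁₂ * (x * y) + b₁₃ * (x * z) + b₂₃ * (y * z)

/-- The support of `A + a x + k x² + b y + l y² + m x y` contains the third point of the line
through any two of its points. -/
abbrev PlaneSupportClosed (A a k b l m : ZMod 3) : Prop :=
  ∀ x y x' y' : ZMod 3, A + (a * x + k * (x * x)) + (b * y + l * (y * y)) + m * (x * y) ≠ 0 →
    A + (a * x' + k * (x' * x')) + (b * y' + l * (y' * y')) + m * (x' * y') ≠ 0 →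
    A + (a * (-x - x') + k * ((-x - x') * (-x - x'))) +
      (b * (-y - y') + l * ((-y - y') * (-y - y'))) + m * ((-x - x') * (-y - y')) ≠ 0

/-- The relations on coefficients that characterize `PlaneSupportClosed`. -/
abbrev PlaneRelation (A a k b l m : ZMod 3) : Prop :=
  ((A = 0 ∧ a * a = k * k) ∨ (A ≠ 0 ∧ (a = 0 ∨ k + A = 0))) ∧
    ((A = 0 ∧ b * b = l * l) ∨ (A ≠ 0 ∧ (b = 0 ∨ l + A = 0))) ∧
    ((k * l = 0 ∧ m = 0) ∨ (k * l ≠ 0 ∧ k = l ∧ m ≠ 0 ∧ (a = 0 ↔ b = 0) ∧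
      (a = 0 ∨ m = 2 * a * b * k)))

set_option synthInstance.maxHeartbeats 400000 in
set_option synthInstance.maxSize 2000 in
theorem PlaneSupportClosed.relation : ∀ A a k b l m : ZMod 3,
    PlaneSupportClosed A a k b l m → PlaneRelation A a k b l m := by
  decide +kernel

/-- The support of a function `f` contains three points of a line `p`, `c`, `-p - c` with `p` on
a coordinate plane, in a way that a closed set containing `p` but not the corner `c` forbids. -/
abbrev CornerConflict (f : ZMod 3 → ZMod 3 → ZMod 3 → ZMod 3) (u v w : ZMod 3) : Prop :=
  ∃ x y z : ZMod 3, x * y * z = 0 ∧ f x y z ≠ 0 ∧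
    ¬ ((-x - u) * (-y - v) * (-z - w) = 0 ↔ f (-x - u) (-y - v) (-z - w) = 0)

/-- The support of `f` on the coordinate planes fails to contain the third point of a line. -/
abbrev PlanesConflict (f : ZMod 3 → ZMod 3 → ZMod 3 → ZMod 3) : Prop :=
  ∃ x y z : ZMod 3, x * y * z = 0 ∧ f x y z ≠ 0 ∧ ∃ x' y' z' : ZMod 3, x' * y' * z' = 0 ∧
    f x' y' z' ≠ 0 ∧
    (-x - x') * (-y - y') * (-z - z') = 0 ∧ f (-x - x') (-y - y') (-z - z') = 0

/-- A quadratic function whose support could arise from a proper affine subspace, or from the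
whole space, violates one of the compatibility conditions at the corners `(±1, ±1, ±1)`. -/
abbrev CornersIncompatible (f : ZMod 3 → ZMod 3 → ZMod 3 → ZMod 3) : Prop :=
  ((∃ u v w : ZMod 3, u * v * w ≠ 0 ∧ f u v w ≠ 0) ∨ ∃ x y z : ZMod 3, x * y * z = 0 ∧ f x y z = 0) ∧
  ((∀ u v w : ZMod 3, u * v * w ≠ 0 → f u v w ≠ 0 → CornerConflict f u v w) ∨ PlanesConflict f)

set_option synthInstance.maxHeartbeats 400000 in
set_option synthInstance.maxSize 2000 in
-- Each hypothesis concerns one coordinate plane and stands right after the coefficients it needs,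
-- so the enumeration can prune early.
theorem cornersIncompatible_of_planeRelation : ∀ A a₁ k₁ a₂ k₂ b₁₂ : ZMod 3,
    PlaneRelation A a₁ k₁ a₂ k₂ b₁₂ →
    ∀ a₃ k₃ b₁₃ : ZMod 3, PlaneRelation A a₁ k₁ a₃ k₃ b₁₃ →
    ∀ b₂₃ : ZMod 3, PlaneRelation A a₂ k₂ a₃ k₃ b₂₃ →
      CornersIncompatible (quadraticValue A a₁ k₁ a₂ k₂ b₁₂ a₃ k₃ b₁₃ b₂₃) := by
  decide +kernel

/-! ### Coverings of the corners of the plane. -/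

theorem eq_all_of_det_ne_zero {D : ZMod 3 → ZMod 3 → Prop}
    (hadd : ∀ y z y' z', D y z → D y' z' → D (y + y') (z + z')) {u v u' v' : ZMod 3}
    (h : D u v) (h' : D u' v') (hdet : u * v' - u' * v ≠ 0) (y z : ZMod 3) : D y z := by
  have hsmul : ∀ (k u v : ZMod 3), D u v → D (k * u) (k * v) := by
    intro k u v h
    have h2 := hadd _ _ _ _ h h
    have hk : k = 0 ∨ k = 1 ∨ k = 2 := by revert k; decide
    rcases hk with rfl | rfl | rfl
    · convert hadd _ _ _ _ h2 h using 1
      · exact (show ∀ a : ZMod 3, 0 * a = a + a + a by decide) u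
      · exact (show ∀ a : ZMod 3, 0 * a = a + a + a by decide) v
    · simpa using h
    · simpa [two_mul] using h2
  -- A nonzero determinant over `𝔽₃` is its own inverse, so Cramer's rule needs no division.
  have hsq : (u * v' - u' * v) * (u * v' - u' * v) = 1 := by
    generalize u * v' - u' * v = t at hdet
    revert t; decide
  convert hadd _ _ _ _ (hsmul ((u * v' - u' * v) * (y * v' - z * u')) u v h)
    (hsmul ((u * v' - u' * v) * (u * z - v * y)) u' v' h') using 1
  · linear_combination -y * hsq
  · linear_combination -z * hsq

/-- The sets `P i` cover the four corners `(±1, ±1)` of the plane `𝔽₃²`,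
no other point is covered exactly once, the differences of two points of a `P i` lie in `D`, and
`P 0`, `P 1` are invariant under `D`. -/
structure PlaneCover (D : ZMod 3 → ZMod 3 → Prop) (P : Fin 3 → ZMod 3 → ZMod 3 → Prop) : Prop where
  add : ∀ y z y' z', D y z → D y' z' → D (y + y') (z + z')
  sub : ∀ i y z y' z', P i y z → P i y' z' → D (y' - y) (z' - z)
  translate : ∀ i, i ≠ 2 → ∀ y z u v, P i y z → D u v → P i (y + u) (z + v)
  third : ∀ y z y' z', P 2 y z → P 2 y' z' → P 2 (-y - y') (-z - z')
  noncorner : ∀ i y z, y * z = 0 → P i y z → ∃ j ≠ i, P j y z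
  corner : ∀ y z, y * z ≠ 0 → ∃ i, P i y z

namespace PlaneCover

variable {D : ZMod 3 → ZMod 3 → Prop} {P : Fin 3 → ZMod 3 → ZMod 3 → Prop}

theorem swap (h : PlaneCover D P) : PlaneCover (fun y z => D z y) (fun i y z => P i z y) where
  add y z y' z' := h.add z y z' y'
  sub i y z y' z' := h.sub i z y z' y'
  translate i hi y z u v := h.translate i hi z y v u
  third y z y' z' := h.third z y z' y'
  noncorner i y z hyz := h.noncorner i z y (mul_comm y z ▸ hyz)
  corner y z hyz := h.corner z y (mul_comm y z ▸ hyz)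

theorem reflect (h : PlaneCover D P) :
    PlaneCover (fun y z => D y (-z)) (fun i y z => P i y (-z)) where
  add y z y' z' a b := by
    have := h.add _ _ _ _ a b
    convert this using 1
    ring
  sub i y z y' z' a b := by
    have := h.sub i _ _ _ _ a b
    convert this using 1
    ring
  translate i hi y z u v a b := by
    have := h.translate i hi _ _ _ _ a b
    convert this using 1
    ring
  third y z y' z' a b := by
    have := h.third _ _ _ _ a b
    convert this using 1
    ring
  noncorner i y z hyz := h.noncorner i y (-z) (by simpa using hyz)
  corner y z hyz := h.corner y (-z) (by simpa using hyz)

/-- Each line `y = c` with `c ≠ 0` meets two of the sets: one set holding both corners also holds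
`(c, 0)`, which must be covered again. Two pairs out of three indices intersect, so one set meets
both lines and gives a direction independent of `(0, 1)`. -/
theorem all_of_axis (h : PlaneCover D P) (h01 : D 0 1) (y z : ZMod 3) : D y z := by
  have two : ∀ c : ZMod 3, c ≠ 0 → ∃ i j, i ≠ j ∧ (∃ z, P i c z) ∧ ∃ z, P j c z := by
    intro c hc
    obtain ⟨i, hi⟩ := h.corner c 1 (by simpa using hc)
    obtain ⟨j, hj⟩ := h.corner c 2 (mul_ne_zero hc (by decide))
    by_cases hij : i = j
    · subst hij
      have h0 : P i c 0 := by
        by_cases hi2 : i = 2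
        · subst hi2
          convert h.third _ _ _ _ hi hj using 1
          · exact (show ∀ a : ZMod 3, a = -a - a by decide) c
          · decide
        · convert h.translate i hi2 _ _ _ _ hj h01 using 1
          · rw [add_zero]
          · decide
      obtain ⟨k, hk, hPk⟩ := h.noncorner i c 0 (mul_zero c) h0
      exact ⟨i, k, hk.symm, ⟨_, h0⟩, _, hPk⟩
    · exact ⟨i, j, hij, ⟨_, hi⟩, _, hj⟩
  obtain ⟨i, j, hij, ⟨z₁, h₁⟩, z₂, h₂⟩ := two 1 (by decide)
  obtain ⟨k, l, hkl, ⟨z₃, h₃⟩, z₄, h₄⟩ := two 2 (by decide)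
  have key : ∀ i z' z'', P i 1 z' → P i 2 z'' → D y z := fun i z' z'' a b =>
    eq_all_of_det_ne_zero h.add h01 (h.sub i _ _ _ _ a b) (by simp; decide) _ _
  have : i = k ∨ i = l ∨ j = k ∨ j = l := by omega
  rcases this with e | e | e | e <;> subst e
  · exact key _ _ _ h₁ h₃
  · exact key _ _ _ h₁ h₄
  · exact key _ _ _ h₂ h₃
  · exact key _ _ _ h₂ h₄

/-- Otherwise each set lies in one diagonal coset. The corners `(2, 1)`, `(1, 2)`, `(1, 1)` lie in
different cosets, so they use up all three sets. At least one of the first two sets is invariant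
under `(1, 1)`; translating its corner gives a noncorner that no other set can cover. -/
theorem all_of_diagonal (h : PlaneCover D P) (h11 : D 1 1) (y z : ZMod 3) : D y z := by
  by_contra hc
  have key : ∀ i y z y' z', P i y z → P i y' z' → z' - z = y' - y := by
    intro i y₁ z₁ y₂ z₂ a b
    by_contra hne
    refine hc (eq_all_of_det_ne_zero h.add h11 (h.sub i _ _ _ _ a b) ?_ _ _)
    rw [one_mul, mul_one]
    exact sub_ne_zero.2 hne
  obtain ⟨i, hi⟩ := h.corner 2 1 (by decide)
  obtain ⟨j, hj⟩ := h.corner 1 2 (by decide)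
  obtain ⟨k, hk⟩ := h.corner 1 1 (by decide)
  have hij : i ≠ j := by rintro rfl; exact absurd (key _ _ _ _ _ hi hj) (by decide)
  have hik : i ≠ k := by rintro rfl; exact absurd (key _ _ _ _ _ hi hk) (by decide)
  have hjk : j ≠ k := by rintro rfl; exact absurd (key _ _ _ _ _ hj hk) (by decide)
  by_cases hi2 : i = 2
  · have h0 := h.translate j (by omega) _ _ _ _ hj h11
    obtain ⟨l, hl, hPl⟩ := h.noncorner j _ _ (by decide) h0
    have : l = i ∨ l = k := by omega
    rcases this with rfl | rfl
    · exact absurd (key _ _ _ _ _ hi hPl) (by decide)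
    · exact absurd (key _ _ _ _ _ hk hPl) (by decide)
  · have h0 := h.translate i hi2 _ _ _ _ hi h11
    obtain ⟨l, hl, hPl⟩ := h.noncorner i _ _ (by decide) h0
    have : l = j ∨ l = k := by omega
    rcases this with rfl | rfl
    · exact absurd (key _ _ _ _ _ hj hPl) (by decide)
    · exact absurd (key _ _ _ _ _ hk hPl) (by decide)

/-- Two of the four corners share a set, and their difference is an axis or diagonal direction up to
symmetry. -/
theorem all (h : PlaneCover D P) (y z : ZMod 3) : D y z := by
  obtain ⟨i, hi⟩ := h.corner 1 1 (by decide)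
  obtain ⟨j, hj⟩ := h.corner 1 2 (by decide)
  obtain ⟨k, hk⟩ := h.corner 2 1 (by decide)
  obtain ⟨l, hl⟩ := h.corner 2 2 (by decide)
  have : i = j ∨ i = k ∨ i = l ∨ j = k ∨ j = l ∨ k = l := by omega
  rcases this with e | e | e | e | e | e <;> subst e
  · exact h.all_of_axis (h.sub _ _ _ _ _ hi hj) y z
  · exact h.swap.all_of_axis (h.sub _ _ _ _ _ hi hk) z y
  · exact h.all_of_diagonal (h.sub _ _ _ _ _ hi hl) y z
  · simpa using h.reflect.all_of_diagonal (h.sub _ _ _ _ _ hj hk) y (-z)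
  · exact h.swap.all_of_axis (h.sub _ _ _ _ _ hj hl) z y
  · exact h.all_of_axis (h.sub _ _ _ _ _ hk hl) y z

end PlaneCover

/-! ### Coverings of the corners of the cube. -/

/-- The sets `B i` cover every point of `𝔽₃³` off the coordinate planes, and cover no point of the
coordinate planes exactly once. -/
structure CubeCover (B : Fin 3 → Set (Fin 3 → ZMod 3)) : Prop where
  closed : ∀ i, ThirdPointClosed (B i)
  noncorner : ∀ i x y z, x * y * z = 0 → ![x, y, z] ∈ B i → ∃ j ≠ i, ![x, y, z] ∈ B j
  corner : ∀ x y z, x * y * z ≠ 0 → ∃ i, ![x, y, z] ∈ B i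

theorem ThirdPointClosed.vec_mem {B : Set (Fin 3 → ZMod 3)} (hB : ThirdPointClosed B)
    {x y z x' y' z' x'' y'' z'' : ZMod 3} (h : ![x, y, z] ∈ B) (h' : ![x', y', z'] ∈ B)
    (hx : x'' = -x - x') (hy : y'' = -y - y') (hz : z'' = -z - z') : ![x'', y'', z''] ∈ B := by
  convert hB _ h _ h' using 1
  simp [hx, hy, hz]

theorem ThirdPointClosed.vec_add_sub_mem {B : Set (Fin 3 → ZMod 3)} (hB : ThirdPointClosed B)
    {x y z x' y' z' x'' y'' z'' a b c : ZMod 3} (h : ![x, y, z] ∈ B) (h' : ![x', y', z'] ∈ B)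
    (h'' : ![x'', y'', z''] ∈ B)
    (hx : a = x + x' - x'') (hy : b = y + y' - y'') (hz : c = z + z' - z'') : ![a, b, c] ∈ B := by
  convert hB.add_sub_mem h h' h'' using 1
  simp [hx, hy, hz]

theorem forall_vec {p : (Fin 3 → ZMod 3) → Prop} (h : ∀ x y z, p ![x, y, z]) (x : Fin 3 → ZMod 3) :
    p x := by
  convert h (x 0) (x 1) (x 2)
  ext i; fin_cases i <;> rfl

theorem ThirdPointClosed.eq_univ_of_plane {B : Set (Fin 3 → ZMod 3)} (hB : ThirdPointClosed B)
    (hZ : ∀ y z, ![0, y, z] ∈ B) {x y z : ZMod 3} (hx : x ≠ 0) (h : ![x, y, z] ∈ B) :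
    B = Set.univ := by
  refine Set.eq_univ_of_forall (forall_vec fun a b c => ?_)
  have : a = 0 ∨ a = x ∨ a = -x :=
    (show ∀ a x : ZMod 3, x ≠ 0 → a = 0 ∨ a = x ∨ a = -x by decide) a x hx
  rcases this with rfl | rfl | rfl
  · exact hZ b c
  · exact hB.vec_add_sub_mem h (hZ (b - y) (c - z)) (hZ 0 0) (by ring) (by ring) (by ring)
  · exact hB.vec_mem h (hZ (-b - y) (-c - z)) (by ring) (by ring) (by ring)

theorem ThirdPointClosed.eq_univ_of_corners {B : Set (Fin 3 → ZMod 3)} (hB : ThirdPointClosed B)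
    (h : ∀ x y z, x * y * z ≠ 0 → ![x, y, z] ∈ B) : B = Set.univ := by
  have h3 : ∀ a : ZMod 3, a = -a - a := by decide
  have h0 : (0 : ZMod 3) = -1 - 2 := by decide
  have h1 : ∀ x y z, x * y ≠ 0 → ![x, y, z] ∈ B := fun x y z hxy => by
    by_cases hz : z = 0
    · subst hz
      exact hB.vec_mem (h x y 1 (by simpa using hxy)) (h x y 2 (mul_ne_zero hxy (by decide)))
        (h3 x) (h3 y) h0
    · exact h x y z (mul_ne_zero hxy hz)
  have h2 : ∀ x y z, x ≠ 0 → ![x, y, z] ∈ B := fun x y z hx => by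
    by_cases hy : y = 0
    · subst hy
      exact hB.vec_mem (h1 x 1 z (by simpa using hx)) (h1 x 2 z (mul_ne_zero hx (by decide)))
        (h3 x) h0 (h3 z)
    · exact h1 x y z (mul_ne_zero hx hy)
  refine Set.eq_univ_of_forall (forall_vec fun x y z => ?_)
  by_cases hx : x = 0
  · subst hx
    exact hB.vec_mem (h2 1 y z (by decide)) (h2 2 y z (by decide)) h0 (h3 y) (h3 z)
  · exact h2 x y z hx

namespace CubeCover

variable {B : Fin 3 → Set (Fin 3 → ZMod 3)}

theorem comp_perm (h : CubeCover B) (π : Equiv.Perm (Fin 3)) : CubeCover (B ∘ π) where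
  closed i := h.closed _
  noncorner i x y z h0 hx := by
    obtain ⟨j, hj, hx⟩ := h.noncorner _ x y z h0 hx
    exact ⟨π.symm j, fun e => hj (by simp [← e]), by simpa using hx⟩
  corner x y z h0 := by
    obtain ⟨i, hi⟩ := h.corner x y z h0
    exact ⟨π.symm i, by simpa using hi⟩

theorem exists_ne_mem_slice (h : CubeCover B) {s : ZMod 3} (hs : s ≠ 0) (i : Fin 3) :
    ∃ j ≠ i, ∃ y z, ![s, y, z] ∈ B j := by
  by_contra! hc
  have hcorner : ∀ y z, y * z ≠ 0 → ![s, y, z] ∈ B i := fun y z hyz => by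
    obtain ⟨j, hj⟩ := h.corner s y z (by rw [mul_assoc]; exact mul_ne_zero hs hyz)
    by_cases hji : j = i
    · exact hji ▸ hj
    · exact absurd hj (hc j hji y z)
  have h0 : ![s, 1, 0] ∈ B i := (h.closed i).vec_mem (hcorner 1 1 (by decide))
    (hcorner 1 2 (by decide)) ((show ∀ a : ZMod 3, a = -a - a by decide) s) (by decide) (by decide)
  obtain ⟨j, hj, hB⟩ := h.noncorner i s 1 0 (mul_zero _) h0
  exact hc j hj _ _ hB

/-- A set meeting both slices `x = 1` and `x = 2` meets `x = 0`. If none does, two of the three sets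
miss the same slice, leaving it to a single set. -/
theorem exists_mem_plane (h : CubeCover B) : ∃ i y z, ![0, y, z] ∈ B i := by
  by_contra! hc
  have hmiss : ∀ i, (∀ y z, ![1, y, z] ∉ B i) ∨ ∀ y z, ![2, y, z] ∉ B i := by
    intro i
    by_contra! hcon
    obtain ⟨⟨y, z, h1⟩, y', z', h2⟩ := hcon
    exact hc i _ _ ((h.closed i).vec_mem h1 h2 (by decide) rfl rfl)
  have key : ∀ s : ZMod 3, s ≠ 0 → ∀ i j, i ≠ j → (∀ y z, ![s, y, z] ∉ B i) →
      (∀ y z, ![s, y, z] ∉ B j) → False := by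
    intro s hs i j hij hi hj
    obtain ⟨k, hk⟩ : ∃ k : Fin 3, ∀ l, l ≠ k → l = i ∨ l = j :=
      (show ∀ i j : Fin 3, i ≠ j → ∃ k : Fin 3, ∀ l, l ≠ k → l = i ∨ l = j by decide) i j hij
    obtain ⟨l, hl, y, z, hB⟩ := h.exists_ne_mem_slice hs k
    rcases hk l hl with rfl | rfl
    · exact hi _ _ hB
    · exact hj _ _ hB
  rcases hmiss 0 with a | a <;> rcases hmiss 1 with b | b <;> rcases hmiss 2 with c | c
  · exact key 1 (by decide) 0 1 (by decide) a b
  · exact key 1 (by decide) 0 1 (by decide) a b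
  · exact key 1 (by decide) 0 2 (by decide) a c
  · exact key 2 (by decide) 1 2 (by decide) b c
  · exact key 1 (by decide) 1 2 (by decide) b c
  · exact key 2 (by decide) 0 2 (by decide) a c
  · exact key 2 (by decide) 0 1 (by decide) a b
  · exact key 2 (by decide) 0 1 (by decide) a b

/-- `PlaneCover.all` applies to a slice `x = s`, with `D` the direction space of the section of `B
0` by `x = 0`. -/
theorem plane_subset (h : CubeCover B) (h01 : ∀ y z, ![0, y, z] ∈ B 0 ↔ ![0, y, z] ∈ B 1)
    (h20 : ∀ y z, ![0, y, z] ∈ B 2 → ![0, y, z] ∈ B 0) (y z : ZMod 3) : ![0, y, z] ∈ B 0 := by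
  obtain ⟨b, c, hb⟩ : ∃ b c, ![0, b, c] ∈ B 0 := by
    obtain ⟨i, y, z, hi⟩ := h.exists_mem_plane
    fin_cases i
    · exact ⟨y, z, hi⟩
    · exact ⟨y, z, (h01 y z).2 hi⟩
    · exact ⟨y, z, h20 y z hi⟩
  -- Directions of `B 2` are controlled by its section at `x = 0`. If that section is empty, `B 2`
  -- misses one of the other slices, and that slice is chosen.
  obtain ⟨s, hs, hs2⟩ : ∃ s : ZMod 3, s ≠ 0 ∧
      ((∃ y z, ![0, y, z] ∈ B 2) ∨ ∀ y z, ![s, y, z] ∉ B 2) := by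
    by_cases hex : ∃ y z, ![0, y, z] ∈ B 2
    · exact ⟨1, by decide, Or.inl hex⟩
    · by_cases h1 : ∀ y z, ![1, y, z] ∉ B 2
      · exact ⟨1, by decide, Or.inr h1⟩
      · push Not at h1
        obtain ⟨y, z, h1⟩ := h1
        exact ⟨2, by decide, Or.inr fun y' z' h2 =>
          hex ⟨_, _, (h.closed 2).vec_mem h1 h2 (by decide) rfl rfl⟩⟩
  have cover : PlaneCover (fun u v => ![0, b + u, c + v] ∈ B 0)
      (fun i y z => ![s, y, z] ∈ B i) := by
    refine ⟨fun y z y' z' h1 h2 => ?_, fun i y z y' z' h1 h2 => ?_, fun i hi y z u v h1 h2 => ?_,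
      fun y z y' z' h1 h2 => ?_, fun i y z hyz h1 => ?_, fun y z hyz => ?_⟩
    · exact (h.closed 0).vec_add_sub_mem h1 h2 hb (by ring) (by ring) (by ring)
    · have key : ∀ i b c, ![0, b, c] ∈ B i → ![s, y, z] ∈ B i → ![s, y', z'] ∈ B i →
          ![0, b + (y' - y), c + (z' - z)] ∈ B i := fun i b c h0 h1 h2 =>
        (h.closed i).vec_add_sub_mem h0 h2 h1 (by ring) (by ring) (by ring)
      fin_cases i
      · exact key 0 _ _ hb h1 h2
      · exact (h01 _ _).2 (key 1 _ _ ((h01 _ _).1 hb) h1 h2)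
      · rcases hs2 with ⟨b', c', h'⟩ | hno
        · exact (h.closed 0).vec_add_sub_mem hb (h20 _ _ (key 2 _ _ h' h1 h2)) (h20 _ _ h')
            (by ring) (by ring) (by ring)
        · exact absurd h1 (hno _ _)
    · have key : ∀ i, ![0, b, c] ∈ B i → ![0, b + u, c + v] ∈ B i → ![s, y, z] ∈ B i →
          ![s, y + u, z + v] ∈ B i := fun i h0 h1 h2 =>
        (h.closed i).vec_add_sub_mem h2 h1 h0 (by ring) (by ring) (by ring)
      fin_cases i
      · exact key 0 hb h2 h1
      · exact key 1 ((h01 _ _).1 hb) ((h01 _ _).1 h2) h1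
      · exact absurd rfl hi
    · exact (h.closed 2).vec_mem h1 h2 ((show ∀ a : ZMod 3, a = -a - a by decide) s) rfl rfl
    · exact h.noncorner i s y z (by rw [mul_assoc, hyz, mul_zero]) h1
    · exact h.corner s y z (by rw [mul_assoc]; exact mul_ne_zero hs hyz)
  have := cover.all (y - b) (z - c)
  simpa using this

/-- With `B k` absent from both slices, `B j` alone must cover their noncorners a second time, and
these span the slices. -/
theorem eq_univ_of_misses (h : CubeCover B) {i j k : Fin 3} (hij : ∀ l, l ≠ k → l = i ∨ l = j)
    (hi : B i = Set.univ) (hik : i ≠ k) (hij' : i ≠ j)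
    (hk : ∀ s y z, s ≠ 0 → ![s, y, z] ∉ B k) : B j = Set.univ := by
  have h3 : ∀ a : ZMod 3, a = -a - a := by decide
  have hnon : ∀ s y z, s ≠ 0 → y * z = 0 → ![s, y, z] ∈ B j := fun s y z hs hyz => by
    obtain ⟨l, hl, hB⟩ := h.noncorner i s y z (by rw [mul_assoc, hyz, mul_zero])
      (hi ▸ Set.mem_univ _)
    have hlk : l ≠ k := by rintro rfl; exact hk _ _ _ hs hB
    rcases hij l hlk with rfl | rfl
    · exact absurd rfl hl
    · exact hB
  have hslice : ∀ s y z, s ≠ 0 → ![s, y, z] ∈ B j := fun s y z hs =>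
    (h.closed j).vec_add_sub_mem (hnon s y 0 hs (mul_zero y)) (hnon s 0 z hs (zero_mul z))
      (hnon s 0 0 hs (zero_mul 0)) (by ring) (by ring) (by ring)
  refine (h.closed j).eq_univ_of_plane (fun y z => ?_) one_ne_zero (hslice 1 0 0 one_ne_zero)
  exact (h.closed j).vec_mem (hslice 1 y z (by decide)) (hslice 2 y z (by decide)) (by decide)
    (h3 y) (h3 z)

theorem exists_two_eq_univ_of_nested (h : CubeCover B)
    (h01 : ∀ y z, ![0, y, z] ∈ B 0 ↔ ![0, y, z] ∈ B 1)
    (h20 : ∀ y z, ![0, y, z] ∈ B 2 → ![0, y, z] ∈ B 0) :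
    ∃ i j, i ≠ j ∧ B i = Set.univ ∧ B j = Set.univ := by
  have h0 := h.plane_subset h01 h20
  have h1 : ∀ y z, ![0, y, z] ∈ B 1 := fun y z => (h01 y z).1 (h0 y z)
  by_cases hex0 : ∃ s y z, s ≠ 0 ∧ ![s, y, z] ∈ B 0
  · obtain ⟨s, y, z, hs, hB⟩ := hex0
    have hu0 := (h.closed 0).eq_univ_of_plane h0 hs hB
    by_cases hex1 : ∃ s y z, s ≠ 0 ∧ ![s, y, z] ∈ B 1
    · obtain ⟨s, y, z, hs, hB⟩ := hex1
      exact ⟨0, 1, by decide, hu0, (h.closed 1).eq_univ_of_plane h1 hs hB⟩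
    · push Not at hex1
      exact ⟨0, 2, by decide, hu0, h.eq_univ_of_misses (k := 1) (by decide) hu0 (by decide)
        (by decide) hex1⟩
  · push Not at hex0
    obtain ⟨j, hj, y, z, hB⟩ := h.exists_ne_mem_slice one_ne_zero 2
    have hj1 : j = 1 := by
      have : j ≠ 0 := by rintro rfl; exact hex0 _ _ _ one_ne_zero hB
      omega
    subst hj1
    have hu1 := (h.closed 1).eq_univ_of_plane h1 one_ne_zero hB
    exact ⟨1, 2, by decide, hu1, h.eq_univ_of_misses (k := 0) (by decide) hu1 (by decide)
      (by decide) hex0⟩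

/-- On the plane `x = 0` there are no corners, so the three sections cover one another and
`ThirdPointClosed.exists_perm` gives the nested form. -/
theorem exists_two_eq_univ (h : CubeCover B) :
    ∃ i j, i ≠ j ∧ B i = Set.univ ∧ B j = Set.univ := by
  have hZ : ThirdPointClosed {x : Fin 3 → ZMod 3 | x 0 = 0} := fun x hx y hy => by
    simp only [Set.mem_ofPred_eq] at *
    simp [hx, hy]
  obtain ⟨π, h01, h20⟩ := ThirdPointClosed.exists_perm
    (B := fun i => B i ∩ {x | x 0 = 0}) (fun i => (h.closed i).inter hZ) (by
      intro i
      refine forall_vec fun x y z hx => ?_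
      have hx0 : x = 0 := hx.2
      obtain ⟨j, hj, hB⟩ := h.noncorner i x y z (by simp [hx0]) hx.1
      exact ⟨j, hj, hB, hx0⟩)
  have mem : ∀ i y z, ![0, y, z] ∈ B i ∩ {x | x 0 = 0} ↔ ![0, y, z] ∈ B i := fun i y z =>
    ⟨fun h => h.1, fun h => ⟨h, rfl⟩⟩
  obtain ⟨i, j, hij, hi, hj⟩ := (h.comp_perm π).exists_two_eq_univ_of_nested
    (fun y z => by
      have := Set.ext_iff.1 h01 ![0, y, z]
      exact (mem _ _ _).symm.trans (this.trans (mem _ _ _)))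
    (fun y z hy => ((mem _ _ _).1 (h20 ((mem _ _ _).2 hy))))
  exact ⟨π i, π j, fun e => hij (π.injective e), hi, hj⟩

end CubeCover

/-! ### The corner indicator is not a sum of three terms over `𝔽₄`. -/

theorem fourLabel_sum_eq_zero : ∀ a b c : ZMod 3, fourLabel a + fourLabel b + fourLabel c = 0 →
    a - b ≠ 0 ∧ a + b + c = 0 := by
  decide

theorem fourLabel_sum_eq_fourLabel_zero : ∀ a b c : ZMod 3,
    fourLabel a + fourLabel b + fourLabel c = fourLabel 0 → a + b + c = 0 → a - b = 0 := by
  decide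

theorem fourLabel_add_eq_fourLabel_zero : ∀ a b : ZMod 3,
    fourLabel a + fourLabel b = fourLabel 0 → a - b ≠ 0 := by
  decide

theorem exists_quadraticValue {q : (Fin 3 → ZMod 3) → ZMod 3} (hq : q ∈ quadraticFunctions 3) :
    ∃ A a₁ k₁ a₂ k₂ b₁₂ a₃ k₃ b₁₃ b₂₃ : ZMod 3, ∀ x y z : ZMod 3, q ![x, y, z] =
      quadraticValue A a₁ k₁ a₂ k₂ b₁₂ a₃ k₃ b₁₃ b₂₃ x y z := by
  obtain ⟨A, a₁, a₂, a₃, k₁, k₂, k₃, b₁₂, b₁₃, b₂₃, h⟩ := exists_coefficients hq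
  exact ⟨A, a₁, k₁, a₂, k₂, b₁₂, a₃, k₃, b₁₃, b₂₃, h⟩

/-- A third difference along the axes expresses the value at `(x, y, z)` through seven values on the
coordinate planes. -/
theorem quadratic_eq_zero_of_planes {q : (Fin 3 → ZMod 3) → ZMod 3} (hq : q ∈ quadraticFunctions 3)
    (h : ∀ x y z, x * y * z = 0 → q ![x, y, z] = 0) (x y z : ZMod 3) : q ![x, y, z] = 0 := by
  have := third_difference_eq_zero hq ![0, 0, 0] ![x, 0, 0] ![0, y, 0] ![0, 0, z]
  simp only [Matrix.cons_add_cons, Matrix.empty_add_empty, add_zero, zero_add] at this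
  rw [h x y 0 (by ring), h x 0 z (by ring), h 0 y z (by ring), h x 0 0 (by ring),
    h 0 y 0 (by ring), h 0 0 z (by ring), h 0 0 0 (by ring)] at this
  simpa using this

theorem cornersIncompatible_of_closed {d : (Fin 3 → ZMod 3) → ZMod 3}
    (hd : d ∈ quadraticFunctions 3)
    (h : ∀ x y z x' y' z', x * y * z = 0 → x' * y' * z' = 0 →
      (-x - x') * (-y - y') * (-z - z') = 0 → d ![x, y, z] ≠ 0 → d ![x', y', z'] ≠ 0 →
      d ![-x - x', -y - y', -z - z'] ≠ 0) :
    CornersIncompatible fun x y z => d ![x, y, z] := by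
  obtain ⟨A, a₁, k₁, a₂, k₂, b₁₂, a₃, k₃, b₁₃, b₂₃, hval⟩ := exists_quadraticValue hd
  have hfun : (fun x y z => d ![x, y, z]) = quadraticValue A a₁ k₁ a₂ k₂ b₁₂ a₃ k₃ b₁₃ b₂₃ := by
    funext x y z
    exact hval x y z
  rw [hfun]
  refine cornersIncompatible_of_planeRelation _ _ _ _ _ _ (PlaneSupportClosed.relation _ _ _ _ _ _ ?_)
    _ _ _ (PlaneSupportClosed.relation _ _ _ _ _ _ ?_) _
    (PlaneSupportClosed.relation _ _ _ _ _ _ ?_)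
  · intro x y x' y'
    have := h x y 0 x' y' 0 (by ring) (by ring) (by ring)
    simpa [hval, quadraticValue] using this
  · intro x y x' y'
    have := h x 0 y x' 0 y' (by ring) (by ring) (by ring)
    simpa [hval, quadraticValue] using this
  · intro x y x' y'
    have := h 0 x y 0 x' y' (by ring) (by ring) (by ring)
    simpa [hval, quadraticValue] using this

theorem no_cube_relation_of_eq_univ {B : Fin 3 → Set (Fin 3 → ZMod 3)}
    {q : Fin 3 → (Fin 3 → ZMod 3) → ZMod 3} (hB : ∀ i, ThirdPointClosed (B i))
    (hq : ∀ i, q i ∈ quadraticFunctions 3)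
    (h : ∀ x y z, ∑ i, (B i).indicator (fun x => fourLabel (q i x)) ![x, y, z] =
      if x * y * z = 0 then 0 else fourLabel 0)
    (h0 : B 0 = Set.univ) (h1 : B 1 = Set.univ) : False := by
  have hin : ∀ x y z, ![x, y, z] ∈ B 2 →
      fourLabel (q 0 ![x, y, z]) + fourLabel (q 1 ![x, y, z]) + fourLabel (q 2 ![x, y, z]) =
        if x * y * z = 0 then 0 else fourLabel 0 := fun x y z hx => by
    rw [← h x y z, Fin.sum_univ_three, h0, h1, Set.indicator_univ, Set.indicator_univ,
      Set.indicator_of_mem hx]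
  have hout : ∀ x y z, ![x, y, z] ∉ B 2 →
      fourLabel (q 0 ![x, y, z]) + fourLabel (q 1 ![x, y, z]) =
        if x * y * z = 0 then 0 else fourLabel 0 := fun x y z hx => by
    rw [← h x y z, Fin.sum_univ_three, h0, h1, Set.indicator_univ, Set.indicator_univ,
      Set.indicator_of_notMem hx, add_zero]
  set d := q 0 - q 1 with hd
  have hdq : d ∈ quadraticFunctions 3 := Submodule.sub_mem _ (hq 0) (hq 1)
  have hplane : ∀ x y z, x * y * z = 0 → (d ![x, y, z] ≠ 0 ↔ ![x, y, z] ∈ B 2) :=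
    fun x y z hxyz => by
      constructor
      · intro hne
        by_contra hx
        have := hout x y z hx
        rw [if_pos hxyz] at this
        exact hne (sub_eq_zero.2 (fourLabel_add_eq_zero _ _ this))
      · intro hx
        have := hin x y z hx
        rw [if_pos hxyz] at this
        exact (fourLabel_sum_eq_zero _ _ _ this).1
  have hinc := cornersIncompatible_of_closed hdq fun x y z x' y' z' e e' e'' hx hx' => by
    rw [hplane _ _ _ e] at hx
    rw [hplane _ _ _ e'] at hx'
    rw [hplane _ _ _ e'']
    exact (hB 2).vec_mem hx hx' rfl rfl rfl
  -- If `B 2` is everything, the sum of the phases vanishes on the planes, hence everywhere; then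
  -- `d` is zero at all corners and nonzero on all planes, against `hinc.1`.
  by_cases hu : B 2 = Set.univ
  · have hs : ∀ x y z, (q 0 + q 1 + q 2) ![x, y, z] = 0 :=
      quadratic_eq_zero_of_planes
        (Submodule.add_mem _ (Submodule.add_mem _ (hq 0) (hq 1)) (hq 2)) fun x y z hxyz => by
          have := hin x y z (hu ▸ Set.mem_univ _)
          rw [if_pos hxyz] at this
          exact (fourLabel_sum_eq_zero _ _ _ this).2
    rcases hinc.1 with ⟨u, v, w, hne, hd0⟩ | ⟨x, y, z, hxyz, hd0⟩
    · have := hin u v w (hu ▸ Set.mem_univ _)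
      rw [if_neg hne] at this
      exact hd0 (fourLabel_sum_eq_fourLabel_zero _ _ _ this (hs u v w))
    · exact (hplane x y z hxyz).2 (hu ▸ Set.mem_univ _) hd0
  · obtain ⟨u, v, w, hne, hB2⟩ : ∃ u v w, u * v * w ≠ 0 ∧ ![u, v, w] ∉ B 2 := by
      by_contra! hc
      exact hu ((hB 2).eq_univ_of_corners hc)
    have hcor : ∀ u v w, u * v * w ≠ 0 → ![u, v, w] ∉ B 2 → d ![u, v, w] ≠ 0 :=
      fun u v w hne hB2 => by
        have := hout u v w hB2
        rw [if_neg hne] at this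
        exact fourLabel_add_eq_fourLabel_zero _ _ this
    rcases hinc.2 with hcc | ⟨x, y, z, e, hx, x', y', z', e', hx', e'', hx''⟩
    · obtain ⟨x, y, z, e, hx, hiff⟩ := hcc u v w hne (hcor u v w hne hB2)
      rw [hplane _ _ _ e] at hx
      -- A line through a point of `B 2` and a corner outside it has its third point outside `B 2`,
      -- where `d` vanishes exactly on the planes.
      have hthird : ![-x - u, -y - v, -z - w] ∉ B 2 := fun hmem =>
        hB2 ((hB 2).vec_mem hmem hx (by ring) (by ring) (by ring))
      refine hiff ⟨fun e0 => ?_, fun hd0 => ?_⟩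
      · by_contra hd0
        exact hthird ((hplane _ _ _ e0).1 hd0)
      · by_contra e0
        exact hcor _ _ _ e0 hthird hd0
    · rw [hplane _ _ _ e] at hx
      rw [hplane _ _ _ e'] at hx'
      exact (hplane _ _ _ e'').2 ((hB 2).vec_mem hx hx' rfl rfl rfl) hx''

/-- Over the field with four elements, the indicator of `{1, 2}³` is not a sum of three functions
`1_B ω^q`. -/
theorem no_cube_relation {B : Fin 3 → Set (Fin 3 → ZMod 3)}
    {q : Fin 3 → (Fin 3 → ZMod 3) → ZMod 3} (hB : ∀ i, ThirdPointClosed (B i))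
    (hq : ∀ i, q i ∈ quadraticFunctions 3)
    (h : ∀ x y z, ∑ i, (B i).indicator (fun x => fourLabel (q i x)) ![x, y, z] =
      if x * y * z = 0 then 0 else fourLabel 0) : False := by
  have hcover : CubeCover B := by
    refine ⟨hB, fun i x y z hxyz hx => ?_, fun x y z hxyz => ?_⟩
    · have := h x y z
      rw [if_pos hxyz] at this
      exact exists_cover_of_sum_fourLabel_eq_zero this i hx
    · by_contra! hc
      have := h x y z
      rw [if_neg hxyz, Finset.sum_eq_zero fun i _ => Set.indicator_of_notMem (hc i) _] at this
      exact fourLabel_ne_zero 0 this.symm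
  obtain ⟨i, j, hij, hi, hj⟩ := hcover.exists_two_eq_univ
  obtain ⟨π, rfl, rfl⟩ : ∃ π : Equiv.Perm (Fin 3), π 0 = i ∧ π 1 = j :=
    (show ∀ i j : Fin 3, i ≠ j → ∃ π : Equiv.Perm (Fin 3), π 0 = i ∧ π 1 = j by decide) i j hij
  exact no_cube_relation_of_eq_univ (B := B ∘ π) (q := q ∘ π) (fun i => hB _) (fun i => hq _)
    (fun x y z => (Equiv.sum_comp π fun i =>
      (B i).indicator (fun x => fourLabel (q i x)) ![x, y, z]).trans (h x y z)) hi hj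

/-! ### Reduction at 2 and projection to `𝔽₄`. -/

/-- A place of `ℂ` above `2`. -/
theorem exists_valuationSubring_two : ∃ V : ValuationSubring ℂ, V.valuation 2 < 1 := by
  let A : Subring ℂ := (Int.castRingHom ℂ).range
  let t : A := ⟨2, 2, by simp⟩
  have hI : Ideal.span {t} ≠ ⊤ := by
    rw [Ne, Ideal.span_singleton_eq_top]
    intro hu
    obtain ⟨⟨_, n, rfl⟩, hs⟩ := hu.exists_right_inv
    have h1 : (2 : ℂ) * (n : ℂ) = 1 := congrArg Subtype.val hs
    have h2 : (2 : ℤ) * n = 1 := by exact_mod_cast h1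
    omega
  -- The proper ideal `(2)` of `ℤ` lies in the nonunits of some valuation ring of `ℂ`.
  obtain ⟨V, -, hV⟩ := Ideal.image_subset_nonunits_valuationSubring _ hI
  exact ⟨V, (ValuationSubring.mem_nonunits_iff (A := V)).1
    (hV ⟨t, Ideal.subset_span rfl, rfl⟩)⟩

theorem fourLabel_orbit : ∀ x y : ZMod 2, (x = 0 ∧ y = 0) ∨ ∃ e : ZMod 3,
    (x, y) = fourLabel (0 + e) ∧ (y, x + y) = fourLabel (1 + e) ∧
      (x + y, x) = fourLabel (2 + e) := by
  decide

/-- A projection of a field of characteristic two onto its subfield with four elements. -/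
theorem exists_projection_fourLabel {k : Type*} [Field k] (h2 : (2 : k) = 0) {ζ : k}
    (hζ : 1 + ζ + ζ ^ 2 = 0) : ∃ φ : k →+ ZMod 2 × ZMod 2, φ 1 = fourLabel 0 ∧
      ∀ u, (∀ a : ZMod 3, φ (u * ζ ^ a.val) = 0) ∨
        ∃ e : ZMod 3, ∀ a : ZMod 3, φ (u * ζ ^ a.val) = fourLabel (a + e) := by
  have : CharP k 2 := CharTwo.of_one_ne_zero_of_two_eq_zero one_ne_zero h2
  let := ZMod.algebra k 2
  have hnot : ζ ^ 2 ∉ Submodule.span (ZMod 2) {(1 : k)} := by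
    rw [Submodule.mem_span_singleton]
    rintro ⟨c, hc⟩
    have hc' : c = 0 ∨ c = 1 :=
      (show ∀ c : ZMod 2, c = 0 ∨ c = 1 by decide) c
    rcases hc' with rfl | rfl
    · rw [zero_smul] at hc
      have : ζ = 0 := pow_eq_zero_iff (two_ne_zero) |>.1 hc.symm
      simp [this] at hζ
    · rw [one_smul] at hc
      have h0 : ζ = 0 := by linear_combination hζ - h2 + hc
      simp [h0] at hc
  obtain ⟨l, hl, hl1⟩ := Submodule.exists_le_ker_of_notMem hnot
  have l1 : l 1 = 0 := hl1 (Submodule.subset_span rfl)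
  have l2 : l (ζ ^ 2) = 1 := by
    generalize l (ζ ^ 2) = c at hl
    revert c; decide
  -- `u ↦ l(ζ²u) + l(u)ω` is linear over `𝔽₄`, where `l` is an `𝔽₂`-functional with `l(1) = 0` and
  -- `l(ζ²) = 1`.
  refine ⟨AddMonoidHom.prod (l.toAddMonoidHom.comp (AddMonoidHom.mulLeft (ζ ^ 2)))
    l.toAddMonoidHom, by simp [l1, l2, fourLabel], fun u => ?_⟩
  have hz3 : ζ ^ 3 = 1 := by linear_combination (ζ - 1) * hζ
  have lz : l (u * ζ) = l (ζ ^ 2 * u) + l u := by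
    rw [← map_add]
    congr 1
    linear_combination u * hζ - (ζ ^ 2 * u + u) * h2
  have e0 : ζ ^ 2 * (u * ζ) = u := by linear_combination u * hz3
  have e1 : ζ ^ 2 * (ζ ^ 2 * u) = u * ζ := by linear_combination u * ζ * hz3
  have e2 : u * ζ ^ 2 = ζ ^ 2 * u := mul_comm _ _
  have v0 : (0 : ZMod 3).val = 0 := rfl
  have v1 : (1 : ZMod 3).val = 1 := rfl
  have v2 : (2 : ZMod 3).val = 2 := rfl
  have hcases : ∀ a : ZMod 3, a = 0 ∨ a = 1 ∨ a = 2 := by decide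
  rcases fourLabel_orbit (l (ζ ^ 2 * u)) (l u) with ⟨hx, hy⟩ | ⟨e, h0, h1, h2⟩
  · left
    intro a
    rcases hcases a with rfl | rfl | rfl
    · simp [v0, hx, hy]
    · simp [v1, e0, lz, hx, hy]
    · simp [v2, e1, e2, lz, hx, hy]
  · right
    refine ⟨e, fun a => ?_⟩
    rcases hcases a with rfl | rfl | rfl
    · rw [← h0]; simp [v0]
    · rw [← h1]; simp [v1, e0, lz]
    · rw [← h2]; simp [v2, e1, e2, lz]

namespace ValuationSubring

variable (V : ValuationSubring ℂ)

theorem omega_mem : omega ∈ V := by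
  rw [← V.valuation_le_one_iff]
  have h : V.valuation omega ^ 3 = 1 := by rw [← map_pow, omega_pow_three, map_one]
  exact (pow_le_one_iff (by norm_num)).1 h.le

/-- The image of `ω` in the residue field. -/
noncomputable def residueOmega : IsLocalRing.ResidueField V :=
  IsLocalRing.residue V ⟨omega, V.omega_mem⟩

theorem one_add_residueOmega : 1 + V.residueOmega + V.residueOmega ^ 2 = 0 := by
  have : (1 + ⟨omega, V.omega_mem⟩ + ⟨omega, V.omega_mem⟩ ^ 2 : V) = 0 :=
    Subtype.ext one_add_omega_add_sq
  rw [residueOmega, ← map_one (IsLocalRing.residue V), ← map_pow, ← map_add, ← map_add, this,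
    map_zero]

theorem residue_eq_zero {x : V} (h : V.valuation x < 1) : IsLocalRing.residue V x = 0 := by
  rw [IsLocalRing.residue_eq_zero_iff]
  exact (V.valuation_lt_one_iff x).2 h

theorem residue_relation {n m : ℕ} {A : Fin m → Set (Fin n → ZMod 3)}
    {q : Fin m → (Fin n → ZMod 3) → ZMod 3} {x : Fin n → ZMod 3} {t : V} {b : Fin m → V}
    (h : (t : ℂ) = ∑ i, (b i : ℂ) * (A i).indicator (fun x => omega ^ (q i x).val) x) :
    IsLocalRing.residue V t = ∑ i, (A i).indicator
      (fun x => IsLocalRing.residue V (b i) * V.residueOmega ^ (q i x).val) x := by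
  classical
  have h' : t = ∑ i, if x ∈ A i then b i * ⟨omega, V.omega_mem⟩ ^ (q i x).val else 0 := by
    apply Subtype.ext
    rw [h, AddSubmonoidClass.coe_finsetSum]
    refine Finset.sum_congr rfl fun i _ => ?_
    by_cases hx : x ∈ A i
    · rw [Set.indicator_of_mem hx, if_pos hx]; rfl
    · rw [Set.indicator_of_notMem hx, if_neg hx]; simp
  rw [h', map_sum]
  refine Finset.sum_congr rfl fun i _ => ?_
  by_cases hx : x ∈ A i
  · rw [Set.indicator_of_mem hx, if_pos hx, map_mul, map_pow, residueOmega]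
  · rw [Set.indicator_of_notMem hx, if_neg hx, map_zero]

end ValuationSubring

/-! ### Excluding three stabilizer states. -/

/-- A coefficient projecting to zero empties its support; any other projects to a power of `ω`,
absorbed into the phase as the constant `e i`. -/
theorem exists_fourLabel_pieces {k : Type*} [Field k] {ζ : k} {φ : k →+ ZMod 2 × ZMod 2}
    (hφ : ∀ u, (∀ a : ZMod 3, φ (u * ζ ^ a.val) = 0) ∨
        ∃ e : ZMod 3, ∀ a : ZMod 3, φ (u * ζ ^ a.val) = fourLabel (a + e))
    {n m : ℕ} {A : Fin m → Set (Fin n → ZMod 3)} {q : Fin m → (Fin n → ZMod 3) → ZMod 3}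
    (hA : ∀ i, ThirdPointClosed (A i)) (hq : ∀ i, q i ∈ quadraticFunctions n) (C : Fin m → k) :
    ∃ (B : Fin m → Set (Fin n → ZMod 3)) (e : Fin m → ZMod 3),
      (∀ i, ThirdPointClosed (B i)) ∧ (∀ i, (fun x => q i x + e i) ∈ quadraticFunctions n) ∧
      (∀ i, (B i).Nonempty → B i = A i ∧ C i ≠ 0) ∧ (∀ i, φ (C i) ≠ 0 → B i = A i) ∧
      ∀ x, φ (∑ i, (A i).indicator (fun x => C i * ζ ^ (q i x).val) x) =
        ∑ i, (B i).indicator (fun x => fourLabel (q i x + e i)) x := by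
  have key : ∀ i, ∃ (B : Set (Fin n → ZMod 3)) (e : ZMod 3), ThirdPointClosed B ∧
      (B.Nonempty → B = A i ∧ C i ≠ 0) ∧ (φ (C i) ≠ 0 → B = A i) ∧
      ∀ x, φ ((A i).indicator (fun x => C i * ζ ^ (q i x).val) x) =
        B.indicator (fun x => fourLabel (q i x + e)) x := by
    intro i
    have h1 : C i * ζ ^ (0 : ZMod 3).val = C i := by simp
    rcases hφ (C i) with h | ⟨e, h⟩
    · refine ⟨∅, 0, fun x hx => hx.elim, fun hx => absurd hx Set.not_nonempty_empty,
        fun hne => absurd ?_ hne, fun x => ?_⟩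
      · rw [← h1, h]
      · by_cases hx : x ∈ A i
        · simp [hx, h]
        · simp [hx]
    · refine ⟨A i, e, hA i, fun _ => ⟨rfl, fun hC => ?_⟩, fun _ => rfl, fun x => ?_⟩
      · have := h 0
        rw [h1, hC, map_zero] at this
        exact fourLabel_ne_zero _ this.symm
      · by_cases hx : x ∈ A i
        · simp [hx, h]
        · simp [hx]
  choose B e hB hne hact hsum using key
  exact ⟨B, e, hB, fun i => Submodule.add_mem _ (hq i) (const_mem_quadraticFunctions (e i)), hne,
    hact, fun x => by rw [map_sum]; exact Finset.sum_congr rfl fun i _ => hsum i x⟩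

/-- Subtracting the multiple of the relation that cancels term `l` creates no new terms, since `d`
is supported where `c` is. -/
theorem exists_fewer_terms {n m : ℕ} {A : Fin m → Set (Fin n → ZMod 3)}
    {g : Fin m → (Fin n → ZMod 3) → ℂ} {ψ : QutritVec n} {c d : Fin m → ℂ}
    (hc : ∀ x, ψ x = ∑ i, c i * (A i).indicator (g i) x)
    (hd : ∀ x, ∑ i, d i * (A i).indicator (g i) x = 0)
    (hne : ∃ i, d i ≠ 0) (hdc : ∀ i, d i ≠ 0 → c i ≠ 0) :
    ∃ c' : Fin m → ℂ, (∀ x, ψ x = ∑ i, c' i * (A i).indicator (g i) x) ∧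
      (Finset.univ.filter fun i => c' i ≠ 0).card < (Finset.univ.filter fun i => c i ≠ 0).card := by
  obtain ⟨l, hl⟩ := hne
  refine ⟨fun i => c i - c l / d l * d i, fun x => ?_, Finset.card_lt_card ?_⟩
  · have : ∑ i, (c i - c l / d l * d i) * (A i).indicator (g i) x =
        ∑ i, c i * (A i).indicator (g i) x -
          c l / d l * ∑ i, d i * (A i).indicator (g i) x := by
      rw [Finset.mul_sum, ← Finset.sum_sub_distrib]
      exact Finset.sum_congr rfl fun i _ => by ring
    rw [this, hd, ← hc, mul_zero, sub_zero]
  · rw [Finset.ssubset_iff_of_subset]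
    · exact ⟨l, by simpa using hdc l hl, by simp [hl]⟩
    · intro i
      simp only [Finset.mem_filter, Finset.mem_univ, true_and]
      intro h hci
      by_cases hdi : d i = 0
      · simp [hci, hdi] at h
      · exact hdc i hdi hci

theorem no_three_term_relation (V : ValuationSubring ℂ) (hV : V.valuation 2 < 1)
    {M : ZMod 3 → ℂ} (h0 : V.valuation (M 0) < 1) (h1 : ∀ a, a ≠ 0 → V.valuation (M a - 1) < 1)
    {A : Fin 3 → Set (Fin 3 → ZMod 3)} {q : Fin 3 → (Fin 3 → ZMod 3) → ZMod 3}
    (hA : ∀ i, ThirdPointClosed (A i)) (hAne : ∀ i, (A i).Nonempty)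
    (hq : ∀ i, q i ∈ quadraticFunctions 3) (c : Fin 3 → ℂ)
    (hc : ∀ x, tensorPower M 3 x =
      ∑ i, c i * (A i).indicator (fun x => omega ^ (q i x).val) x) : False := by
  have hMmem : ∀ a, M a ∈ V := fun a => by
    by_cases ha : a = 0
    · rw [ha, ← V.valuation_le_one_iff]; exact h0.le
    · have := V.add_mem _ _ ((V.valuation_le_one_iff _).1 (h1 a ha).le) V.one_mem
      rwa [sub_add_cancel] at this
  have hres0 : IsLocalRing.residue V ⟨M 0, hMmem 0⟩ = 0 := V.residue_eq_zero h0
  have hres1 : ∀ a, a ≠ 0 → IsLocalRing.residue V ⟨M a, hMmem a⟩ = 1 := fun a ha => by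
    rw [← sub_eq_zero, ← map_one (IsLocalRing.residue V), ← map_sub]
    exact V.residue_eq_zero (h1 a ha)
  have h2 : (2 : IsLocalRing.ResidueField V) = 0 := by
    rw [← map_ofNat (IsLocalRing.residue V) 2]
    exact V.residue_eq_zero hV
  obtain ⟨φ, hφ1, hφ⟩ := exists_projection_fourLabel h2 V.one_add_residueOmega
  -- No base case is needed: vanishing coefficients are integral.
  induction hn : (Finset.univ.filter fun i => c i ≠ 0).card using Nat.strong_induction_on
    generalizing c with
  | _ n ih =>
  subst hn
  by_cases hint : ∀ i, c i ∈ V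
  · obtain ⟨B, e, hB, hBq, -, -, hsum⟩ := exists_fourLabel_pieces hφ hA hq
      fun i => IsLocalRing.residue V ⟨c i, hint i⟩
    refine no_cube_relation hB hBq fun x y z => ?_
    let t : V := ⟨M x, hMmem x⟩ * ⟨M y, hMmem y⟩ * ⟨M z, hMmem z⟩
    have ht : (t : ℂ) = ∑ i, ((⟨c i, hint i⟩ : V) : ℂ) *
        (A i).indicator (fun x => omega ^ (q i x).val) ![x, y, z] := by
      rw [← hc, tensorPower, Fin.prod_univ_three]
      rfl
    rw [← hsum, ← V.residue_relation ht, map_mul (IsLocalRing.residue V),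
      map_mul (IsLocalRing.residue V)]
    by_cases hxyz : x * y * z = 0
    · rw [if_pos hxyz]
      rcases mul_eq_zero.1 hxyz with hxy | rfl
      · rcases mul_eq_zero.1 hxy with rfl | rfl
        · rw [hres0, zero_mul, zero_mul, map_zero]
        · rw [hres0, mul_zero, zero_mul, map_zero]
      · rw [hres0, mul_zero, map_zero]
    · rw [if_neg hxyz]
      obtain ⟨hxy, hz⟩ := mul_ne_zero_iff.1 hxyz
      obtain ⟨hx, hy⟩ := mul_ne_zero_iff.1 hxy
      rw [hres1 x hx, hres1 y hy, hres1 z hz, mul_one, mul_one, hφ1]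
  -- After division by the largest coefficient the left side reduces to zero, while term `j` reduces
  -- to coefficient one and survives projection.
  · obtain ⟨j, -, hj⟩ := Finset.exists_max_image Finset.univ (fun i => V.valuation (c i))
      Finset.univ_nonempty
    have hj1 : 1 < V.valuation (c j) := by
      push Not at hint
      obtain ⟨i, hi⟩ := hint
      rw [← V.valuation_le_one_iff, not_le] at hi
      exact hi.trans_le (hj i (Finset.mem_univ i))
    have hj0 : 0 < V.valuation (c j) := zero_lt_one.trans hj1
    have hcj : c j ≠ 0 := by
      rintro h
      rw [h, map_zero] at hj0
      exact lt_irrefl _ hj0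
    have hb : ∀ i, c i / c j ∈ V := fun i => by
      rw [← V.valuation_le_one_iff, map_div₀, div_le_one₀ hj0]
      exact hj i (Finset.mem_univ i)
    have hinv : V.valuation (c j)⁻¹ < 1 := by
      rw [map_inv₀]
      exact inv_lt_one_of_one_lt₀ hj1
    have hinvmem : (c j)⁻¹ ∈ V := by
      rw [← V.valuation_le_one_iff]; exact hinv.le
    obtain ⟨B, e, hB, hBq, hBne, hBact, hsum⟩ := exists_fourLabel_pieces hφ hA hq
      fun i => IsLocalRing.residue V ⟨c i / c j, hb i⟩
    have hMprod : ∀ x, tensorPower M 3 x ∈ V := fun x => V.toSubring.prod_mem fun i _ => hMmem _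
    have hzero : ∀ x, ∑ i, (B i).indicator (fun x => fourLabel (q i x + e i)) x = 0 := by
      intro x
      let t : V := ⟨(c j)⁻¹, hinvmem⟩ * ⟨_, hMprod x⟩
      have ht : (t : ℂ) = ∑ i, ((⟨c i / c j, hb i⟩ : V) : ℂ) *
          (A i).indicator (fun x => omega ^ (q i x).val) x := by
        change (c j)⁻¹ * tensorPower M 3 x = _
        rw [hc, Finset.mul_sum]
        exact Finset.sum_congr rfl fun i _ => by
          change _ = c i / c j * _
          ring
      have h := V.residue_relation ht
      rw [map_mul, V.residue_eq_zero (x := ⟨(c j)⁻¹, hinvmem⟩) hinv, zero_mul] at h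
      rw [← hsum, ← h, map_zero]
    have hBj : B j = A j := by
      refine hBact j ?_
      have : (⟨c j / c j, hb j⟩ : V) = 1 := Subtype.ext (div_self hcj)
      rw [this, map_one, hφ1]
      exact fourLabel_ne_zero 0
    obtain ⟨d, ⟨l, hl⟩, hdne, hdsum⟩ := exists_relation_of_sum_fourLabel_eq_zero hB hBq hzero
      ⟨j, hBj ▸ hAne j⟩
    -- The factor `ω ^ e i` undoes the phase shift made in projecting to `𝔽₄`.
    obtain ⟨c', hc', hlt⟩ := exists_fewer_terms (d := fun i => d i * omega ^ (e i).val) hc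
      (fun x => by
        rw [← hdsum x]
        refine Finset.sum_congr rfl fun i _ => ?_
        by_cases hdi : d i = 0
        · simp [hdi]
        · rw [(hBne i (hdne i hdi)).1]
          by_cases hx : x ∈ A i
          · rw [Set.indicator_of_mem hx, Set.indicator_of_mem hx, pow_val_add omega_pow_three]
            ring
          · rw [Set.indicator_of_notMem hx, Set.indicator_of_notMem hx, mul_zero, mul_zero])
      ⟨l, mul_ne_zero hl (pow_ne_zero _ (isPrimitiveRoot_omega.ne_zero (by norm_num)))⟩
      (fun i hdi hci => (hBne i (hdne i (left_ne_zero_of_mul hdi))).2 (by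
        have : (⟨c i / c j, hb i⟩ : V) = 0 := Subtype.ext (by simp [hci])
        rw [this, map_zero]))
    exact ih _ hlt c' hc' rfl

/-- If, up to a scalar and a shift of the basis, `M` reduces to `(0, 1, 1)` at a place above `2`,
then `M ⊗ M ⊗ M` is not a combination of three stabilizer states. -/
theorem not_hasStabilizerDecomposition_three (V : ValuationSubring ℂ) (hV : V.valuation 2 < 1)
    {M : ZMod 3 → ℂ} {s : ℂ} (a₀ : ZMod 3) (h0 : V.valuation (s * M a₀) < 1)
    (h1 : ∀ a, a ≠ a₀ → V.valuation (s * M a - 1) < 1) :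
    ¬ HasStabilizerDecomposition (tensorPower M 3) 3 := by
  rintro ⟨c, σ, hσ, hsum⟩
  choose A q γ hAne hA hq hval using fun i => (hσ i).exists_indicator
  let v : Fin 3 → ZMod 3 := fun _ => a₀
  refine no_three_term_relation V hV (M := fun a => s * M (a + a₀)) (by simpa using h0)
    (fun a ha => h1 _ (by simpa using ha)) (A := fun i => {x | x + v ∈ A i})
    (q := fun i x => q i (x + v)) (fun i x hx y hy => ?_) (fun i => ?_)
    (fun i => comp_affine_mem_quadraticFunctions (hq i) LinearMap.id v)
    (fun i => s ^ 3 * c i * γ i) fun x => ?_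
  · have := hA i _ hx _ hy
    have h3 : ∀ a : ZMod 3, -a - a = a := by decide
    change -x - y + v ∈ A i
    convert this using 1
    ext j
    simp only [Pi.add_apply, Pi.sub_apply, Pi.neg_apply]
    linear_combination -h3 (v j)
  · obtain ⟨x, hx⟩ := hAne i
    exact ⟨x - v, by simpa using hx⟩
  · have h := congrFun hsum (x + v)
    simp only [tensorPower, Finset.sum_apply, Pi.smul_apply, smul_eq_mul, hval] at h
    rw [tensorPower, Finset.prod_mul_distrib, Finset.prod_const, Finset.card_univ, Fintype.card_fin]
    change s ^ 3 * ∏ i, M ((x + v) i) = _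
    rw [h, Finset.mul_sum]
    refine Finset.sum_congr rfl fun i _ => ?_
    have : ({x | x + v ∈ A i} : Set _).indicator (fun x => omega ^ (q i (x + v)).val) x =
        (A i).indicator (fun x => omega ^ (q i x).val) (x + v) := rfl
    rw [this]
    ring

/-! ### Submultiplicativity and the asymptotic exponent. -/

/-- The tensor product of an `n`-qutrit vector and an `m`-qutrit vector. -/
def tensorProduct {n m : ℕ} (σ : QutritVec n) (τ : QutritVec m) : QutritVec (n + m) :=
  fun x => σ (fun i => x (Fin.castAdd m i)) * τ (fun j => x (Fin.natAdd n j))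

theorem isStabilizerState_tensorProduct {n m : ℕ} {σ : QutritVec n} {τ : QutritVec m}
    (hσ : IsStabilizerState σ) (hτ : IsStabilizerState τ) :
    IsStabilizerState (tensorProduct σ τ) := by
  obtain ⟨k, x₀, W, Q, hW, hQ, rfl⟩ := hσ
  obtain ⟨l, x₁, W', Q', hW', hQ', rfl⟩ := hτ
  let U : Matrix (Fin (n + m)) (Fin (k + l)) (ZMod 3) :=
    (Matrix.fromBlocks W 0 0 W').submatrix finSumFinEquiv.symm finSumFinEquiv.symm
  have hU : ∀ y : Fin (k + l) → ZMod 3, U.mulVec y =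
      Fin.append (W.mulVec fun i => y (Fin.castAdd l i))
        (W'.mulVec fun i => y (Fin.natAdd k i)) := by
    intro y
    rw [Matrix.submatrix_mulVec_equiv, Matrix.fromBlocks_mulVec]
    ext i
    refine Fin.addCases (fun i => ?_) (fun i => ?_) i
    · simp [Function.comp_def]
    · simp [Function.comp_def]
  have hinj := mulVec_injective_of_rank_eq hW
  have hinj' := mulVec_injective_of_rank_eq hW'
  refine ⟨k + l, Fin.append x₀ x₁, U, MvPolynomial.rename (Fin.castAdd l) Q +
    MvPolynomial.rename (Fin.natAdd k) Q', rank_eq_of_mulVec_injective fun y z hyz => ?_,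
    (MvPolynomial.totalDegree_add _ _).trans (max_le
      ((MvPolynomial.totalDegree_rename_le _ _).trans hQ)
      ((MvPolynomial.totalDegree_rename_le _ _).trans hQ')), ?_⟩
  · rw [Matrix.mulVecLin_apply, Matrix.mulVecLin_apply, hU, hU] at hyz
    have h1 : (fun i => y (Fin.castAdd l i)) = fun i => z (Fin.castAdd l i) := hinj (by
      ext i
      simpa using congrFun hyz (Fin.castAdd m i))
    have h2 : (fun i => y (Fin.natAdd k i)) = fun i => z (Fin.natAdd k i) := hinj' (by
      ext i
      simpa using congrFun hyz (Fin.natAdd n i))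
    ext i
    refine Fin.addCases (fun i => ?_) (fun i => ?_) i
    · exact congrFun h1 i
    · exact congrFun h2 i
  · ext z
    rw [tensorProduct, canonicalState_apply, canonicalState_apply, canonicalState_apply,
      mul_mul_mul_comm, ← Complex.ofReal_mul, Fintype.sum_mul_sum, ← Fintype.sum_prod_type',
      ← (Fin.appendEquiv k l).sum_comp]
    congr 1
    · rw [pow_add, Real.sqrt_mul (by positivity), one_div_mul_one_div]
    · refine Finset.sum_congr rfl fun ⟨y, y'⟩ _ => ?_
      have hiff : z = Fin.append x₀ x₁ + U.mulVec (Fin.append y y') ↔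
          (fun i => z (Fin.castAdd m i)) = x₀ + W.mulVec y ∧
          (fun i => z (Fin.natAdd n i)) = x₁ + W'.mulVec y' := by
        rw [hU]
        constructor
        · rintro rfl
          constructor <;> ext i <;> simp
        · rintro ⟨h1, h2⟩
          ext i
          refine Fin.addCases (fun i => ?_) (fun i => ?_) i
          · simpa using congrFun h1 i
          · simpa using congrFun h2 i
      have e1 : (Fin.append y y') ∘ Fin.castAdd l = y := by ext i; simp
      have e2 : (Fin.append y y') ∘ Fin.natAdd k = y' := by ext i; simp
      have e0 : Fin.appendEquiv k l (y, y') = Fin.append y y' := rfl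
      simp only [e0, hiff, map_add, MvPolynomial.eval_rename, e1, e2,
        pow_val_add omega_pow_three]
      by_cases h1 : (fun i => z (Fin.castAdd m i)) = x₀ + W.mulVec y <;>
      by_cases h2 : (fun i => z (Fin.natAdd n i)) = x₁ + W'.mulVec y' <;> simp [h1, h2]

theorem HasStabilizerDecomposition.tensorProduct {n m r s : ℕ} {ψ : QutritVec n} {θ : QutritVec m}
    (hψ : HasStabilizerDecomposition ψ r) (hθ : HasStabilizerDecomposition θ s) :
    HasStabilizerDecomposition (tensorProduct ψ θ) (r * s) := by
  obtain ⟨c, σ, hσ, rfl⟩ := hψ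
  obtain ⟨d, τ, hτ, rfl⟩ := hθ
  refine ⟨fun i => c (finProdFinEquiv.symm i).1 * d (finProdFinEquiv.symm i).2,
    fun i => _root_.tensorProduct (σ (finProdFinEquiv.symm i).1) (τ (finProdFinEquiv.symm i).2),
    fun i => isStabilizerState_tensorProduct (hσ _) (hτ _), ?_⟩
  rw [finProdFinEquiv.symm.sum_comp fun p : Fin r × Fin s =>
    (c p.1 * d p.2) • _root_.tensorProduct (σ p.1) (τ p.2), Fintype.sum_prod_type]
  ext x
  simp only [_root_.tensorProduct, Finset.sum_apply, Pi.smul_apply, smul_eq_mul, Finset.sum_mul_sum]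
  refine Finset.sum_congr rfl fun i _ => Finset.sum_congr rfl fun j _ => by ring

theorem tensorPower_add (M : ZMod 3 → ℂ) (n m : ℕ) :
    tensorPower M (n + m) = tensorProduct (tensorPower M n) (tensorPower M m) := by
  ext x
  simp [tensorPower, tensorProduct, Fin.prod_univ_add]

theorem hasStabilizerDecomposition_stabilizerRank {n : ℕ} (ψ : QutritVec n) :
    HasStabilizerDecomposition ψ (stabilizerRank ψ) :=
  Nat.sInf_mem (s := {r | HasStabilizerDecomposition ψ r}) (exists_hasStabilizerDecomposition ψ)

theorem HasStabilizerDecomposition.stabilizerRank_le {n r : ℕ} {ψ : QutritVec n}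
    (h : HasStabilizerDecomposition ψ r) : stabilizerRank ψ ≤ r :=
  Nat.sInf_le h

theorem HasStabilizerDecomposition.succ {n r : ℕ} {ψ : QutritVec n}
    (h : HasStabilizerDecomposition ψ r) : HasStabilizerDecomposition ψ (r + 1) := by
  obtain ⟨c, σ, hσ, rfl⟩ := h
  refine ⟨Fin.cons 0 c, Fin.cons (ket 0) σ, fun i => ?_, ?_⟩
  · refine Fin.cases ?_ (fun i => ?_) i
    · exact isStabilizerState_ket 0
    · exact hσ i
  · simp [Fin.sum_univ_succ]

theorem HasStabilizerDecomposition.mono {n r s : ℕ} {ψ : QutritVec n}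
    (h : HasStabilizerDecomposition ψ r) (hrs : r ≤ s) : HasStabilizerDecomposition ψ s := by
  induction hrs with
  | refl => exact h
  | step _ ih => exact ih.succ

theorem stabilizerRank_tensorPower_add_le (M : ZMod 3 → ℂ) (n m : ℕ) :
    stabilizerRank (tensorPower M (n + m)) ≤
      stabilizerRank (tensorPower M n) * stabilizerRank (tensorPower M m) := by
  rw [tensorPower_add]
  exact ((hasStabilizerDecomposition_stabilizerRank _).tensorProduct
    (hasStabilizerDecomposition_stabilizerRank _)).stabilizerRank_le

theorem stabilizerRank_tensorPower_add_mul_le (M : ZMod 3 → ℂ) (n k m : ℕ) :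
    stabilizerRank (tensorPower M (m + n * k)) ≤
      stabilizerRank (tensorPower M n) ^ k * stabilizerRank (tensorPower M m) := by
  induction k with
  | zero => simp
  | succ k ih =>
    have e : m + n * (k + 1) = n + (m + n * k) := by ring
    rw [e]
    refine (stabilizerRank_tensorPower_add_le M _ _).trans ?_
    rw [pow_succ', mul_assoc]
    exact Nat.mul_le_mul_left _ ih

/-- The stabilizer rank of a fixed tensor power bounds the asymptotic exponent. -/
theorem asymptoticExponent_le (M : ZMod 3 → ℂ) {n : ℕ} (hn : 0 < n)
    (h1 : 1 ≤ stabilizerRank (tensorPower M n)) :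
    asymptoticExponent M ≤
      ((Real.logb 3 (stabilizerRank (tensorPower M n)) / n : ℝ) : EReal) := by
  set R := stabilizerRank (tensorPower M n) with hR
  -- Bounds the rank for every remainder `m % n`; the summand 1 keeps its logarithm nonnegative.
  let C : ℝ := 1 + ∑ r ∈ Finset.range n, (stabilizerRank (tensorPower M r) : ℝ)
  have hC : 1 ≤ C := le_add_of_nonneg_right (Finset.sum_nonneg fun r _ => Nat.cast_nonneg _)
  have hR1 : (1 : ℝ) ≤ R := by exact_mod_cast h1
  have hlogR : 0 ≤ Real.logb 3 R := Real.logb_nonneg (by norm_num) hR1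
  have hlogC : 0 ≤ Real.logb 3 C := Real.logb_nonneg (by norm_num) hC
  have hn' : (0 : ℝ) < n := by exact_mod_cast hn
  have hbound : ∀ m : ℕ, 0 < m → Real.logb 3 (stabilizerRank (tensorPower M m)) / m ≤
      Real.logb 3 R / n + Real.logb 3 C / m := by
    intro m hm
    have hm' : (0 : ℝ) < m := by exact_mod_cast hm
    have hlog : Real.logb 3 (stabilizerRank (tensorPower M m)) ≤
        (m / n : ℝ) * Real.logb 3 R + Real.logb 3 C := by
      rcases Nat.eq_zero_or_pos (stabilizerRank (tensorPower M m)) with h0 | hpos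
      · rw [h0]
        simp only [Nat.cast_zero, Real.logb_zero]
        positivity
      · have hle : (stabilizerRank (tensorPower M m) : ℝ) ≤ (R : ℝ) ^ (m / n) * C := by
          have := stabilizerRank_tensorPower_add_mul_le M n (m / n) (m % n)
          rw [Nat.mod_add_div] at this
          have h' : (stabilizerRank (tensorPower M m) : ℝ) ≤
              (R : ℝ) ^ (m / n) * stabilizerRank (tensorPower M (m % n)) := by exact_mod_cast this
          refine h'.trans (mul_le_mul_of_nonneg_left ?_ (by positivity))
          have hs := Finset.single_le_sum (f := fun r => (stabilizerRank (tensorPower M r) : ℝ))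
            (fun r _ => Nat.cast_nonneg _) (Finset.mem_range.2 (Nat.mod_lt m hn))
          exact hs.trans (le_add_of_nonneg_left zero_le_one)
        calc Real.logb 3 (stabilizerRank (tensorPower M m))
            ≤ Real.logb 3 ((R : ℝ) ^ (m / n) * C) :=
              Real.logb_le_logb_of_le (by norm_num) (by exact_mod_cast hpos) hle
          _ = (m / n : ℕ) * Real.logb 3 R + Real.logb 3 C := by
              rw [Real.logb_mul (by positivity) (by positivity), Real.logb_pow]
          _ ≤ _ := by
              gcongr
              exact Nat.cast_div_le
    calc Real.logb 3 (stabilizerRank (tensorPower M m)) / m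
        ≤ ((m / n : ℝ) * Real.logb 3 R + Real.logb 3 C) / m := by gcongr
      _ = _ := by field_simp
  have hlim : Filter.Tendsto (fun m : ℕ =>
      ((Real.logb 3 R / n + Real.logb 3 C / m : ℝ) : EReal)) Filter.atTop
      (nhds ((Real.logb 3 R / n : ℝ) : EReal)) := by
    refine (continuous_coe_real_ereal.tendsto _).comp ?_
    simpa using (tendsto_const_nhds (x := Real.logb 3 R / n)).add
      (tendsto_const_div_atTop_nhds_zero_nat (Real.logb 3 C))
  rw [← hlim.limsup_eq]
  refine Filter.limsup_le_limsup ?_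
  filter_upwards [Filter.eventually_gt_atTop 0] with m hm
  exact EReal.coe_le_coe_iff.2 (hbound m hm)

/-! ### Explicit decompositions into four states. -/

theorem exists_isStabilizerState_smul_eq_phase {n : ℕ} (Q : MvPolynomial (Fin n) (ZMod 3))
    (hQ : Q.totalDegree ≤ 2) : ∃ (a : ℂ) (σ : QutritVec n), IsStabilizerState σ ∧
      (fun z => omega ^ (MvPolynomial.eval z Q).val) = a • σ := by
  have hne : ((1 / Real.sqrt (3 ^ n) : ℝ) : ℂ) ≠ 0 := by
    rw [Complex.ofReal_ne_zero]
    positivity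
  refine ⟨((1 / Real.sqrt (3 ^ n) : ℝ) : ℂ)⁻¹, canonicalState 0 1 Q,
    ⟨n, 0, 1, Q, by rw [Matrix.rank_one, Fintype.card_fin], hQ, rfl⟩, ?_⟩
  ext z
  rw [Pi.smul_apply, canonicalState_apply, smul_eq_mul, inv_mul_cancel_left₀ hne]
  simp

theorem hasStabilizerDecomposition_of_smul {n r : ℕ} {ψ : QutritVec n} {f : Fin r → QutritVec n}
    (hf : ∀ i, ∃ (a : ℂ) (σ : QutritVec n), IsStabilizerState σ ∧ f i = a • σ) (c : Fin r → ℂ)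
    (h : ∀ x, ψ x = ∑ i, c i * f i x) : HasStabilizerDecomposition ψ r := by
  choose a σ hσ haf using hf
  refine ⟨fun i => c i * a i, σ, hσ, ?_⟩
  ext x
  rw [h, Finset.sum_apply]
  refine Finset.sum_congr rfl fun i _ => ?_
  rw [haf i, Pi.smul_apply, Pi.smul_apply, smul_eq_mul, smul_eq_mul, mul_assoc]

theorem eval_sum_sq_sub {n : ℕ} (a b : ZMod 3) (z : Fin n → ZMod 3) :
    MvPolynomial.eval z (MvPolynomial.C a * ∑ i, (MvPolynomial.X i - MvPolynomial.C b) ^ 2) =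
      a * ∑ i, (z i - b) ^ 2 := by
  simp

theorem totalDegree_sum_sq_sub_le {n : ℕ} (a b : ZMod 3) :
    (MvPolynomial.C a * ∑ i : Fin n, (MvPolynomial.X i - MvPolynomial.C b) ^ 2 :
      MvPolynomial (Fin n) (ZMod 3)).totalDegree ≤ 2 := by
  refine (MvPolynomial.totalDegree_mul _ _).trans ?_
  rw [MvPolynomial.totalDegree_C, zero_add]
  refine MvPolynomial.totalDegree_finsetSum_le fun i _ => ?_
  refine (MvPolynomial.totalDegree_pow _ _).trans ?_
  have : (MvPolynomial.X i - MvPolynomial.C b : MvPolynomial (Fin n) (ZMod 3)).totalDegree ≤ 1 :=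
    (MvPolynomial.totalDegree_sub _ _).trans (by simp [MvPolynomial.totalDegree_X])
  omega

theorem discreteFourier_three (g₀ g₁ g₂ : ℂ) (a : ZMod 3) :
    (g₀ + g₁ + g₂) / 3 + (g₀ + g₁ * omega ^ 2 + g₂ * omega) / 3 * omega ^ a.val +
      (g₀ + g₁ * omega + g₂ * omega ^ 2) / 3 * omega ^ (2 * a).val =
    if a = 0 then g₀ else if a = 1 then g₁ else g₂ := by
  have h := one_add_omega_add_sq
  have h3 := omega_pow_three
  have hcases : a = 0 ∨ a = 1 ∨ a = 2 := by revert a; decide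
  have v0 : (0 : ZMod 3).val = 0 := rfl
  have v1 : (1 : ZMod 3).val = 1 := rfl
  have v2 : (2 : ZMod 3).val = 2 := rfl
  have v4 : (2 * 2 : ZMod 3).val = 1 := rfl
  rcases hcases with rfl | rfl | rfl
  · rw [mul_zero, v0, if_pos rfl]
    linear_combination (g₁ + g₂) / 3 * h
  · rw [mul_one, v1, v2, if_neg (by decide), if_pos rfl]
    linear_combination (g₀ + g₂) / 3 * h + (2 * g₁ + g₂ * omega) / 3 * h3
  · rw [v4, v2, if_neg (by decide), if_neg (by decide)]
    linear_combination (g₀ + g₁) / 3 * h + (2 * g₂ + g₁ * omega) / 3 * h3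

/-- A single-qutrit vector taking one value at `b` and another value elsewhere has a third tensor
power that is a combination of four stabilizer states. -/
theorem hasStabilizerDecomposition_four_of_two_values {M : ZMod 3 → ℂ} {b : ZMod 3} {u w : ℂ}
    (hb : M b = u) (hM : ∀ a, a ≠ b → M a = w) :
    HasStabilizerDecomposition (tensorPower M 3) 4 := by
  let Q : ZMod 3 → MvPolynomial (Fin 3) (ZMod 3) := fun a =>
    MvPolynomial.C a * ∑ i, (MvPolynomial.X i - MvPolynomial.C b) ^ 2
  refine hasStabilizerDecomposition_of_smul
    (f := ![fun z => omega ^ (MvPolynomial.eval z (Q 0)).val,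
      fun z => omega ^ (MvPolynomial.eval z (Q 1)).val,
      fun z => omega ^ (MvPolynomial.eval z (Q 2)).val, ket fun _ => b]) (fun i => ?_)
    -- Fourier coefficients of the amplitude as a function of the number of coordinates off `b`,
    -- modulo 3. Class 0 gets the value `w ^ 3` of count 3; the last coefficient corrects count 0.
    ![(w ^ 3 + u ^ 2 * w + u * w ^ 2) / 3,
      (w ^ 3 + u ^ 2 * w * omega ^ 2 + u * w ^ 2 * omega) / 3,
      (w ^ 3 + u ^ 2 * w * omega + u * w ^ 2 * omega ^ 2) / 3, u ^ 3 - w ^ 3] fun x => ?_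
  · fin_cases i
    · exact exists_isStabilizerState_smul_eq_phase _ (totalDegree_sum_sq_sub_le _ _)
    · exact exists_isStabilizerState_smul_eq_phase _ (totalDegree_sum_sq_sub_le _ _)
    · exact exists_isStabilizerState_smul_eq_phase _ (totalDegree_sum_sq_sub_le _ _)
    · exact ⟨1, _, isStabilizerState_ket _, (one_smul _ _).symm⟩
  · have hval : ∀ a : ZMod 3, (M a = u ∧ (a - b) ^ 2 = 0 ∧ a = b) ∨
        (M a = w ∧ (a - b) ^ 2 = 1 ∧ a ≠ b) := fun a => by
      by_cases ha : a = b
      · exact Or.inl ⟨ha ▸ hb, by simp [ha], ha⟩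
      · exact Or.inr ⟨hM a ha,
          (show ∀ a b : ZMod 3, a ≠ b → (a - b) ^ 2 = 1 by decide) a b ha, ha⟩
    have hF := discreteFourier_three (w ^ 3) (u ^ 2 * w) (u * w ^ 2)
      (∑ i, (x i - b) ^ 2)
    have hket : ket (fun _ => b) x = if x 0 = b ∧ x 1 = b ∧ x 2 = b then (1 : ℂ) else 0 := by
      rw [ket, Pi.single_apply]
      refine if_congr ⟨?_, fun ⟨h0, h1, h2⟩ => ?_⟩ rfl rfl
      · rintro rfl
        exact ⟨rfl, rfl, rfl⟩
      · ext i
        fin_cases i <;> assumption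
    simp only [Q, eval_sum_sq_sub, Fin.sum_univ_four, Matrix.cons_val, zero_mul, ZMod.val_zero,
      pow_zero, mul_one, one_mul]
    rw [hF, hket, tensorPower, Fin.prod_univ_three, Fin.sum_univ_three]
    have k3 : (1 + 1 + 1 : ZMod 3) = 0 := rfl
    have k20 : (1 + 1 : ZMod 3) ≠ 0 := by decide
    have k21 : (1 + 1 : ZMod 3) ≠ 1 := by decide
    rcases hval (x 0) with ⟨e0, f0, g0⟩ | ⟨e0, f0, g0⟩ <;>
    rcases hval (x 1) with ⟨e1, f1, g1⟩ | ⟨e1, f1, g1⟩ <;>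
    rcases hval (x 2) with ⟨e2, f2, g2⟩ | ⟨e2, f2, g2⟩ <;>
    rw [e0, e1, e2, f0, f1, f2] <;>
    simp [g0, g1, g2, k3, k20, k21, -mul_eq_mul_right_iff, -mul_eq_mul_left_iff] <;> ring

theorem phase_sub_phase_neg {χ : ZMod 3 → ℂ} (h0 : χ 0 = 0) (h1 : χ 1 = 1) (h2 : χ 2 = -1)
    (a : ZMod 3) : omega ^ a.val - omega ^ (-a).val = (omega - omega ^ 2) * χ a := by
  have hcases : a = 0 ∨ a = 1 ∨ a = 2 := by revert a; decide
  have v1 : (1 : ZMod 3).val = 1 := rfl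
  have v2 : (2 : ZMod 3).val = 2 := rfl
  have n1 : (-1 : ZMod 3).val = 2 := rfl
  have n2 : (-2 : ZMod 3).val = 1 := rfl
  rcases hcases with rfl | rfl | rfl
  · simp [h0]
  · rw [v1, n1, h1]; ring
  · rw [v2, n2, h2]; ring

/-- The third tensor power of a multiple of `|1⟩ - |2⟩` is a combination of four stabilizer
states. -/
theorem hasStabilizerDecomposition_four_of_odd {M : ZMod 3 → ℂ} {s : ℂ} (h0 : M 0 = 0)
    (h1 : M 1 = s) (h2 : M 2 = -s) : HasStabilizerDecomposition (tensorPower M 3) 4 := by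
  let Q : ZMod 3 → ZMod 3 → MvPolynomial (Fin 3) (ZMod 3) := fun a b =>
    MvPolynomial.C a * (MvPolynomial.X 0 * MvPolynomial.X 1) + MvPolynomial.C b * MvPolynomial.X 2
  have hQ : ∀ a b, (Q a b).totalDegree ≤ 2 := fun a b => by
    refine (MvPolynomial.totalDegree_add _ _).trans (max_le ?_ ?_)
    · refine (MvPolynomial.totalDegree_mul _ _).trans ?_
      rw [MvPolynomial.totalDegree_C, zero_add]
      refine (MvPolynomial.totalDegree_mul _ _).trans ?_
      rw [MvPolynomial.totalDegree_X, MvPolynomial.totalDegree_X]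
    · refine (MvPolynomial.totalDegree_mul _ _).trans ?_
      rw [MvPolynomial.totalDegree_C, MvPolynomial.totalDegree_X]
      norm_num
  have hev : ∀ a b (z : Fin 3 → ZMod 3), MvPolynomial.eval z (Q a b) =
      a * (z 0 * z 1) + b * z 2 := fun a b z => by simp [Q]
  refine hasStabilizerDecomposition_of_smul
    (f := ![fun z => omega ^ (MvPolynomial.eval z (Q 1 1)).val,
      fun z => omega ^ (MvPolynomial.eval z (Q 1 (-1))).val,
      fun z => omega ^ (MvPolynomial.eval z (Q (-1) 1)).val,
      fun z => omega ^ (MvPolynomial.eval z (Q (-1) (-1))).val]) (fun i => ?_)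
    -- From `(ω^{xy} - ω^{-xy})(ω^z - ω^{-z}) = (ω - ω²)² χ(xyz)` and `(ω - ω²)² = -3`.
    ![-s ^ 3 / 3, s ^ 3 / 3, s ^ 3 / 3, -s ^ 3 / 3] fun x => ?_
  · fin_cases i <;> exact exists_isStabilizerState_smul_eq_phase _ (hQ _ _)
  · let χ : ZMod 3 → ℂ := ![0, 1, -1]
    have hcases : ∀ a : ZMod 3, a = 0 ∨ a = 1 ∨ a = 2 := by decide
    have hM : ∀ a, M a = s * χ a := fun a => by
      rcases hcases a with rfl | rfl | rfl
      · rw [h0]; exact (mul_zero s).symm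
      · rw [h1]; exact (mul_one s).symm
      · rw [h2]; exact (mul_neg_one s).symm
    have hmul : ∀ a b, χ (a * b) = χ a * χ b := fun a b => by
      have c0 : χ 0 = 0 := rfl
      have c1 : χ 1 = 1 := rfl
      have c2 : χ 2 = -1 := rfl
      have h22 : (2 * 2 : ZMod 3) = 1 := rfl
      rcases hcases a with rfl | rfl | rfl <;> rcases hcases b with rfl | rfl | rfl <;>
        simp [c0, c1, c2, h22]
    have hxy := phase_sub_phase_neg (χ := χ) rfl rfl rfl (x 0 * x 1)
    have hz := phase_sub_phase_neg (χ := χ) rfl rfl rfl (x 2)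
    simp only [hev, Fin.sum_univ_four, Matrix.cons_val, one_mul, neg_one_mul,
      pow_val_add omega_pow_three]
    rw [tensorPower, Fin.prod_univ_three, hM, hM, hM]
    have hδ : (omega - omega ^ 2) * (omega - omega ^ 2) = -3 := by
      linear_combination (omega ^ 2 - 3 * omega + 3) * one_add_omega_add_sq
    rw [hmul] at hxy
    have hprod := congrArg₂ (· * ·) hxy hz
    linear_combination (s ^ 3 / 3) * hprod + s ^ 3 / 3 * χ (x 0) * χ (x 1) * χ (x 2) * hδ

/-! ### The three states. -/

theorem rank_eq_four_of_place {M : ZMod 3 → ℂ} (h4 : HasStabilizerDecomposition (tensorPower M 3) 4)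
    (s : ℂ) (a₀ : ZMod 3) (V : ValuationSubring ℂ) (hV : V.valuation 2 < 1)
    (h0 : V.valuation (s * M a₀) < 1) (h1 : ∀ a, a ≠ a₀ → V.valuation (s * M a - 1) < 1) :
    stabilizerRank (tensorPower M 3) = 4 ∧
      asymptoticExponent M ≤ ((Real.logb 3 4 / 3 : ℝ) : EReal) := by
  have hrank : stabilizerRank (tensorPower M 3) = 4 := by
    refine le_antisymm h4.stabilizerRank_le ?_
    by_contra! hlt
    exact not_hasStabilizerDecomposition_three V hV a₀ h0 h1
      ((hasStabilizerDecomposition_stabilizerRank _).mono (Nat.le_of_lt_succ hlt))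
  refine ⟨hrank, ?_⟩
  have := asymptoticExponent_le M (n := 3) (by norm_num) (by omega)
  rw [hrank] at this
  exact_mod_cast this

theorem strangeState_values : strangeState 0 = 0 ∧
    strangeState 1 = ((1 / Real.sqrt 2 : ℝ) : ℂ) ∧
    strangeState 2 = -((1 / Real.sqrt 2 : ℝ) : ℂ) := by
  have h01 : (0 : ZMod 3) ≠ 1 := by decide
  have h02 : (0 : ZMod 3) ≠ 2 := by decide
  have h12 : (1 : ZMod 3) ≠ 2 := by decide
  simp [strangeState, ket, h02, h12, h12.symm]

theorem hadamardEigenstate_values :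
    hadamardEigenstate 0 = ((1 / Real.sqrt (3 - Real.sqrt 3) : ℝ) : ℂ) ∧
    ∀ a, a ≠ 0 → hadamardEigenstate a =
      ((1 / Real.sqrt (3 - Real.sqrt 3) : ℝ) : ℂ) * (((Real.sqrt 3 - 1) / 2 : ℝ) : ℂ) := by
  have h02 : (0 : ZMod 3) ≠ 2 := by decide
  have h12 : (1 : ZMod 3) ≠ 2 := by decide
  refine ⟨by simp [hadamardEigenstate, ket, h02], fun a ha => ?_⟩
  have ha' : a = 1 ∨ a = 2 := by revert a; decide
  rcases ha' with rfl | rfl <;>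
    simp [hadamardEigenstate, ket, h02.symm, h12, h12.symm]

theorem norrellState_values : norrellState 2 = -2 * ((1 / Real.sqrt 6 : ℝ) : ℂ) ∧
    ∀ a, a ≠ 2 → norrellState a = ((1 / Real.sqrt 6 : ℝ) : ℂ) := by
  have h02 : (0 : ZMod 3) ≠ 2 := by decide
  have h12 : (1 : ZMod 3) ≠ 2 := by decide
  refine ⟨by simp [norrellState, ket, h02.symm, h12.symm, mul_comm],
    fun a ha => ?_⟩
  have ha' : a = 0 ∨ a = 1 := by revert a; decide
  rcases ha' with rfl | rfl <;> simp [norrellState, ket, h02, h12]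

theorem ofReal_sqrt_mul_one_div {x : ℝ} (hx : 0 < x) :
    ((Real.sqrt x : ℝ) : ℂ) * ((1 / Real.sqrt x : ℝ) : ℂ) = 1 := by
  rw [← Complex.ofReal_mul, mul_one_div_cancel (Real.sqrt_ne_zero'.2 hx), Complex.ofReal_one]

/-- `(√3 + 1)² = 2(2 + √3)`, and `2 + √3` is integral. -/
theorem valuation_sqrt_three_add_one_lt_one (V : ValuationSubring ℂ) (hV : V.valuation 2 < 1) :
    V.valuation (((Real.sqrt 3 : ℝ) : ℂ) + 1) < 1 := by
  have hsq : ((Real.sqrt 3 : ℝ) : ℂ) ^ 2 = 3 := by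
    rw [← Complex.ofReal_pow, Real.sq_sqrt (by norm_num)]
    norm_num
  have hmem : ((Real.sqrt 3 : ℝ) : ℂ) ∈ V := by
    rw [← V.valuation_le_one_iff]
    refine (pow_le_one_iff (n := 2) (by norm_num)).1 ?_
    rw [← map_pow, hsq, V.valuation_le_one_iff]
    exact natCast_mem V 3
  have h2 : V.valuation (2 + ((Real.sqrt 3 : ℝ) : ℂ)) ≤ 1 := by
    rw [V.valuation_le_one_iff]
    exact V.add_mem _ _ (natCast_mem V 2) hmem
  have key : V.valuation (((Real.sqrt 3 : ℝ) : ℂ) + 1) ^ 2 < 1 := by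
    have e : (((Real.sqrt 3 : ℝ) : ℂ) + 1) ^ 2 = 2 * (2 + ((Real.sqrt 3 : ℝ) : ℂ)) := by
      linear_combination hsq
    rw [← map_pow, e, map_mul]
    exact mul_lt_one_of_lt_of_le hV h2
  exact (pow_lt_one_iff (by norm_num)).1 key

theorem theorem2 :
    ∀ M ∈ ({strangeState, hadamardEigenstate, norrellState} : Set (ZMod 3 → ℂ)),
      stabilizerRank (tensorPower M 3) = 4 ∧
        asymptoticExponent M ≤ ((Real.logb 3 4 / 3 : ℝ) : EReal) := by
  obtain ⟨V, hV⟩ := exists_valuationSubring_two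
  have hV2 : V.valuation (-2) < 1 := by rwa [Valuation.map_neg]
  rintro M (rfl | rfl | rfl)
  · obtain ⟨h0, h1, h2⟩ := strangeState_values
    have hs := ofReal_sqrt_mul_one_div (x := 2) (by norm_num)
    refine rank_eq_four_of_place (hasStabilizerDecomposition_four_of_odd h0 h1 h2)
      ((Real.sqrt 2 : ℝ) : ℂ) 0 V hV (by rw [h0, mul_zero, map_zero]; exact zero_lt_one)
      fun a ha => ?_
    have ha' : a = 1 ∨ a = 2 := by revert a; decide
    rcases ha' with rfl | rfl
    · rw [h1, hs, sub_self, map_zero]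
      exact zero_lt_one
    · rw [h2, mul_neg, hs]
      convert hV2 using 2
      norm_num
  · obtain ⟨h0, h1⟩ := hadamardEigenstate_values
    have h3 : Real.sqrt 3 < 3 := by
      rw [Real.sqrt_lt' (by norm_num)]
      norm_num
    have hs := ofReal_sqrt_mul_one_div (x := 3 - Real.sqrt 3) (by linarith)
    have ht : (((Real.sqrt 3 : ℝ) : ℂ) + 1) * (((Real.sqrt 3 - 1) / 2 : ℝ) : ℂ) = 1 := by
      have : (Real.sqrt 3 + 1) * ((Real.sqrt 3 - 1) / 2) = 1 := by
        have := Real.sq_sqrt (show (0 : ℝ) ≤ 3 by norm_num)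
        linear_combination this / 2
      exact_mod_cast congrArg (fun r : ℝ => (r : ℂ)) this
    -- Since `(√3 + 1)(√3 - 1)/2 = 1`, this scaling turns the amplitudes into `(√3 + 1, 1, 1)`.
    refine rank_eq_four_of_place (hasStabilizerDecomposition_four_of_two_values h0 h1)
      ((((Real.sqrt 3 : ℝ) : ℂ) + 1) * ((Real.sqrt (3 - Real.sqrt 3) : ℝ) : ℂ)) 0 V hV ?_
      fun a ha => ?_
    · rw [h0, mul_assoc, hs, mul_one]
      exact valuation_sqrt_three_add_one_lt_one V hV
    · have : (((Real.sqrt 3 : ℝ) : ℂ) + 1) * ((Real.sqrt (3 - Real.sqrt 3) : ℝ) : ℂ) *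
          hadamardEigenstate a - 1 = 0 := by
        rw [h1 a ha]
        linear_combination (((Real.sqrt 3 : ℝ) : ℂ) + 1) * (((Real.sqrt 3 - 1) / 2 : ℝ) : ℂ) * hs
          + ht
      rw [this, map_zero]
      exact zero_lt_one
  · obtain ⟨h2, h1⟩ := norrellState_values
    have hs := ofReal_sqrt_mul_one_div (x := 6) (by norm_num)
    -- The rescaled amplitudes are `(1, 1, -2)`, so the vanishing residue sits at basis index 2.
    refine rank_eq_four_of_place (hasStabilizerDecomposition_four_of_two_values h2 h1)
      ((Real.sqrt 6 : ℝ) : ℂ) 2 V hV ?_ fun a ha => ?_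
    · rw [h2, mul_left_comm, hs, mul_one]
      exact hV2
    · rw [h1 a ha, hs, sub_self, map_zero]
      exact zero_lt_one
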